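/- **Theorem 1.2 (Non-geometric hyperuniformity).** Let $q \ge 2$, let $T$ be the $(q+1)$-regular tree with vertex set $V$, root $o$ and graph metric $d$, and put $\tau = 2\pi/\log q$. A (weighted) point process on $T$ is a Borel probability measure $\mu$ on the space $\mathscr M_+(T) \cong [0,\infty)^{V}$ of locally finite positive measures $p = \sum_{x} p(x)\delta_x$ on $V$, with the topology of pointwise convergence. It is *invariant* if $g_*\mu=\mu$ for every automorphism $g$ of $T$ (acting by push-forward of measures), and *locally square-integrable* if $\int p(x)^2\,d\mu(p)<\infty$ for every vertex $x$. For $\lambda \in \mathbb C\setminus \frac{\tau}{2}\mathbb Z$ and $n \ge 0$ let $$\omega_\lambda(n) = c_q(\lambda) q^{-(1/2-i\lambda)n} + c_q(-\lambda)q^{-(1/2+i\lambda)n},\qquad c_q(\lambda)=\frac{1}{q^{1/2}+q^{-1/2}}\,\frac{q^{1/2+i\lambda}-q^{-1/2-i\lambda}}{q^{i\lambda}-q^{-i\lambda}},$$ and $\omega_{\tau j/2}(n) = \bigl(1+\tfrac{q^{1/2}-q^{-1/2}}{q^{1/2}+q^{-1/2}}\,n\bigr)(-1)^{jn}q^{-n/2}$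 for $j\in\mathbb Z$. For a finitely supported $f: V\to\mathbb C$ put $\mathbb S f(p)=\sum_x p(x)f(x)$ and $\hat f(\lambda)=\sum_x f(x)\,\omega_\lambda(d(o,x))$; call $f$ *radial* if it is invariant under all automorphisms of $T$ that fix $o$. Let $$\Lambda_q = i[0,\tfrac12]\,\cup\,(0,\tfrac{\pi}{\log q})\,\cup\,\bigl(\tfrac{\pi}{\log q}+i[0,\tfrac12]\bigr)\subset\mathbb C .$$ The *diffraction measure* $\sigma_\mu$ of an invariant locally square-integrable point process $\mu$ is the unique finite positive Borel measure on $\Lambda_q$ such that $$\int \mathbb S f_1\,\overline{\mathbb S f_2}\,d\mu=\int_{\Lambda_q}\hat f_1\,\overline{\hat f_2}\,d\sigma_\mu$$ for all finitely supported radial $f_1,f_2$. With $B_r(o)=\{x : d(o,x)\le r\}$ and $\chi_{B_r(o)}$ its indicator function, the *sub-oscillatory number variance* of $\mu$ is $$\mathrm{NV}^*_\mu(r)=\int_{\Lambda_q\setminus\{\frac i2,\ \frac{\pi}{\log q}+\frac i2\}}|\hat\chi_{B_r(o)}(\lambda)|^2\,d\sigma_\mu(\lambda),\qquad r = 0,1,2,\dots$$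 Let $\mu$ be an invariant locally square-integrable point process on $T$. Then the following hold (upper and lower limits are taken in $[0,+\infty]$). * Suppose that $\mu$ is non-degenerate, in the sense that it is not the case that for $\mu$-almost every $p$ one has $p(x)=p(y)$ for all vertices $x,y$ at even distance. Then $$\limsup_{r\to+\infty}\frac{\mathrm{NV}^*_\mu(r)}{|B_r(o)|}>0 ,$$ so $\mu$ is not geometrically hyperuniform, which would mean that this upper limit is $0$. * If $\sigma_\mu(\{0,\frac{\pi}{\log q}\})>0$, then $$\liminf_{r\to+\infty}\frac{\mathrm{NV}^*_\mu(r)}{r^2|B_r(o)|}>0 .$$ * If $\delta\in(0,1)$ is such that $\sigma_\mu(i[\frac\delta2,\frac12))>0$ or $\sigma_\mu(\frac{\pi}{\log q}+i[\frac\delta2,\frac12))>0$, then $$\liminf_{r\to+\infty}\frac{\mathrm{NV}^*_\mu(r)}{|B_r(o)|^{1+\delta}}>0 .$$ -/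

import Mathlib

open MeasureTheory Filter
open scoped NNReal ENNReal ComplexConjugate

noncomputable section

namespace TreeProcess

/-! ### Spherical functions of the `(q + 1)`-regular tree -/

/-- The period `τ = 2π / log q`. -/
def period (q : ℕ) : ℝ := 2 * Real.pi / Real.log q

/-- The Harish-Chandra `c`-function
`c_q(l) = (q^{1/2} + q^{-1/2})⁻¹ (q^{1/2 + il} - q^{-1/2 - il}) / (q^{il} - q^{-il})`
(only used away from the zeros `(τ/2)ℤ` of the denominator). -/
def cFun (q : ℕ) (l : ℂ) : ℂ :=
  1 / ((q : ℂ) ^ (1 / 2 : ℂ) + (q : ℂ) ^ (-(1 / 2) : ℂ)) *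
    (((q : ℂ) ^ (1 / 2 + Complex.I * l) - (q : ℂ) ^ (-(1 / 2) - Complex.I * l)) /
      ((q : ℂ) ^ (Complex.I * l) - (q : ℂ) ^ (-(Complex.I * l))))

open Classical in
/-- The value `ω_l(n)` of the spherical function with parameter `l` at distance `n` from the root:
`c(l) q^{-(1/2 - il)n} + c(-l) q^{-(1/2 + il)n}` if `l ∉ (τ/2)ℤ`, and
`(1 + n (q^{1/2} - q^{-1/2}) / (q^{1/2} + q^{-1/2})) (-1)^{jn} q^{-n/2}` if `l = (τ/2) j` with
`j ∈ ℤ` (such a `j` is unique). -/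
def sphericalFun (q : ℕ) (l : ℂ) (n : ℕ) : ℂ :=
  if h : ∃ j : ℤ, l = ((period q / 2 * (j : ℝ) : ℝ) : ℂ) then
    (1 + ((q : ℂ) ^ (1 / 2 : ℂ) - (q : ℂ) ^ (-(1 / 2) : ℂ)) /
        ((q : ℂ) ^ (1 / 2 : ℂ) + (q : ℂ) ^ (-(1 / 2) : ℂ)) * (n : ℂ)) *
      (-1 : ℂ) ^ (h.choose * (n : ℤ)) * (q : ℂ) ^ (-((n : ℂ) / 2))
  else
    cFun q l * (q : ℂ) ^ (-((1 / 2 - Complex.I * l) * (n : ℂ))) +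
      cFun q (-l) * (q : ℂ) ^ (-((1 / 2 + Complex.I * l) * (n : ℂ)))

/-- `a + i s = {a + i t : t ∈ s}` for real `a` and a set `s` of reals. -/
def verticalSet (a : ℝ) (s : Set ℝ) : Set ℂ :=
  (fun t : ℝ => (a : ℂ) + Complex.I * (t : ℂ)) '' s

/-- The set `Λ_q = i[0, 1/2] ∪ (0, τ/2) ∪ (τ/2 + i[0, 1/2])` of parameters of the
positive-definite spherical functions. -/
def Lam (q : ℕ) : Set ℂ :=
  verticalSet 0 (Set.Icc 0 (1 / 2)) ∪
    (fun t : ℝ => (t : ℂ)) '' Set.Ioo 0 (period q / 2) ∪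
    verticalSet (period q / 2) (Set.Icc 0 (1 / 2))

/-! ### Point processes on a tree

A locally finite positive measure on the (discrete) vertex set `V` is the same thing as a function
`p : V → ℝ≥0`, the point masses. The space of these carries the product `σ`-algebra, which is the
Borel `σ`-algebra of pointwise convergence since `V` is countable for the trees considered. A point
process is a probability measure `μ` on `V → ℝ≥0`. -/

variable {V : Type*}

/-- Invariance under all automorphisms `g` of the tree, acting by push-forward of measures:
`(g_* p)({x}) = p({g⁻¹ x})`. -/
def IsInvariant (T : SimpleGraph V) (μ : Measure (V → ℝ≥0)) : Prop :=
  ∀ g : T ≃g T, μ.map (fun (p : V → ℝ≥0) (x : V) => p (g.symm x)) = μ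

/-- Local square-integrability: `∫ p({x})² dμ(p) < ∞` for every vertex `x`. -/
def IsLocallySquareIntegrable (μ : Measure (V → ℝ≥0)) : Prop :=
  ∀ x : V, ∫⁻ p, ((p x : ℝ≥0∞)) ^ 2 ∂μ < ∞

/-- The linear statistic `S f (p) = ∑ₓ p({x}) f(x)` of a finitely supported function `f`. -/
def linearStatistic (f : V → ℂ) (p : V → ℝ≥0) : ℂ :=
  ∑ᶠ x, ((p x : ℝ) : ℂ) * f x

/-- Finitely supported radial functions: those invariant under the stabilizer of the root `o` in
the automorphism group. They correspond to the elements `g ↦ f (g o)` of the Hecke algebra. -/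
structure IsFinRadial (T : SimpleGraph V) (o : V) (f : V → ℂ) : Prop where
  finite_support : f.support.Finite
  radial : ∀ k : T ≃g T, k o = o → ∀ x, f (k x) = f x

/-- The spherical transform of (the lift `g ↦ f (g o)` of) a finitely supported function `f`, where
Haar measure on the automorphism group gives mass `1` to the stabilizer of `o`, so that it projects
to the counting measure on the vertices. -/
def sphericalTransform (q : ℕ) (T : SimpleGraph V) (o : V) (f : V → ℂ) (l : ℂ) : ℂ :=
  ∑ᶠ x, f x * sphericalFun q l (T.dist o x)

/-- `σ` is a diffraction measure of `μ`: a finite positive Borel measure carried by `Λ_q` with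
`⟨S f₁, S f₂⟩_{L²(μ)} = ∫ f̂₁ conj(f̂₂) dσ` for all finitely supported radial `f₁, f₂`. -/
structure IsDiffractionMeasure (q : ℕ) (T : SimpleGraph V) (o : V) (μ : Measure (V → ℝ≥0))
    (σ : Measure ℂ) : Prop where
  finite : IsFiniteMeasure σ
  carried : σ (Lam q)ᶜ = 0
  inner_eq : ∀ f₁ f₂ : V → ℂ, IsFinRadial T o f₁ → IsFinRadial T o f₂ →
    ∫ p, linearStatistic f₁ p * conj (linearStatistic f₂ p) ∂μ =
      ∫ l in Lam q, sphericalTransform q T o f₁ l * conj (sphericalTransform q T o f₂ l) ∂σ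

open Classical in
/-- The diffraction measure `σ_μ` of `μ`. (An invariant locally square-integrable point process on
the regular tree has exactly one; the value is `0` for a `μ` that has none.) -/
def diffractionMeasure (q : ℕ) (T : SimpleGraph V) (o : V) (μ : Measure (V → ℝ≥0)) : Measure ℂ :=
  if h : ∃ σ : Measure ℂ, IsDiffractionMeasure q T o μ σ then h.choose else 0

/-! ### Number variances of balls -/

/-- The ball `B_r(o)` of the graph metric. -/
def ball (T : SimpleGraph V) (o : V) (r : ℕ) : Set V := {x | T.dist o x ≤ r}

/-- The number of vertices `|B_r(o)|`. -/
def ballCard (T : SimpleGraph V) (o : V) (r : ℕ) : ℝ := ((ball T o r).ncard : ℝ)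

/-- The `Q`-conditional variance `∫_{Λ_q ∖ Q} |f̂|² dσ_μ` of the linear statistic `S f`. -/
def condVar (q : ℕ) (T : SimpleGraph V) (o : V) (μ : Measure (V → ℝ≥0)) (f : V → ℂ)
    (Q : Set ℂ) : ℝ :=
  ∫ l in Lam q \ Q, ‖sphericalTransform q T o f l‖ ^ 2 ∂(diffractionMeasure q T o μ)

/-- The sub-oscillatory number variance `NV*_μ(r)`: the conditional variance of `S χ_{B_r(o)}` with
respect to `Q = {i/2, τ/2 + i/2}`. -/
def subOscNumberVariance (q : ℕ) (T : SimpleGraph V) (o : V) (μ : Measure (V → ℝ≥0))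
    (r : ℕ) : ℝ :=
  condVar q T o μ ((ball T o r).indicator 1)
    {Complex.I / 2, ((period q / 2 : ℝ) : ℂ) + Complex.I / 2}

/-- A configuration that is constant on each of the two bipartition classes of the tree. -/
def IsClassConstant (T : SimpleGraph V) (p : V → ℝ≥0) : Prop :=
  ∀ x y : V, Even (T.dist x y) → p x = p y

end TreeProcess

end

/-!
Write `y = 2 cos (l log q)` for `l ∈ Λ_q`; this is a real number in `[-(√q + 1/√q), √q + 1/√q]`,
and the endpoints are attained exactly at the two trivial parameters `i/2` and `τ/2 + i/2`. The
normalized ball transforms `a_r = q^{-r/2} χ̂_{B_r(o)}(l)` satisfy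
`a_{r+2} = y a_{r+1} - a_r`, `a₀ = 1`, `a₁ = q^{-1/2} + y` (`sphericalTransform_ball`), and
`|B_r(o)|` lies between `1` and `3 q^r`. So all three bounds are bounds from below on
`∫ a_r² dσ_μ` off the trivial parameters.

* The quadratic form `a_r² - y a_r a_{r+1} + a_{r+1}²` does not depend on `r` and is positive for
  nontrivial `l`. Hence `a_r² + a_{r+1}²` is bounded below by a positive function of `l` alone
  (`le_ballSeq_sq_add_sq`), and the first claim follows as soon as `σ_μ` charges some nontrivial
  parameter.
* At the critical parameters `y = ±2` and `|a_r|` grows linearly, as `ballSeq_two` and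
  `ballSeq_neg_two` show.
* On the complementary series `y = ±(z + z⁻¹)` with `z = q^t`, and `|a_r| ≥ z^r`
  (`pow_le_ballSeq_sq`).

It remains to see that `σ_μ` exists and that it charges a nontrivial parameter when `μ` is
non-degenerate. Both use that the automorphism group of the tree is distance-transitive
(`exists_iso_of_dist_eq`). For existence, let `P` be the projection of `L²(μ)` onto the vectors
fixed by the stabilizer of `o` under the Koopman representation `U`, and let `g` move `o` to a
neighbour. Then `A = P U_g P` is a self-adjoint contraction which acts on the projections of the
evaluations `p ↦ p({x})` as the normalized adjacency operator acts on radial functions, so the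
projection of the evaluation at `x` is `p_n(A)` applied to the evaluation at `o`, where
`n = d(o, x)` and `p_n` is the polynomial with `ω_l(n) = p_n(ω_l(1))`
(`exists_sphericalSpectralMeasure`). The spectral measure of `A`, carried by `[-1, 1]`, is
transported to `Λ_q` by a section of `l ↦ ω_l(1)` (`exists_isDiffractionMeasure`). Finally
`ω_l(2) = 1` at the trivial parameters; a measure `σ_μ` carried by them forces the evaluations at
two vertices at distance two to agree in `L²(μ)` (`ae_isClassConstant_of_diffraction`).
-/

namespace TreeProcess

/-! ### Spectral measures of self-adjoint contractions -/

open scoped InnerProductSpace CompactlySupported in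
/-- The spectral measure of a self-adjoint contraction `A` at a vector `v`: the Riesz measure of the
positive functional `f ↦ ⟪v, f(A) v⟫` on continuous functions on the spectrum. -/
theorem exists_spectralMeasure {H : Type*} [NormedAddCommGroup H] [InnerProductSpace ℂ H]
    [CompleteSpace H] (A : H →L[ℂ] H) (hA : IsSelfAdjoint A) (hA1 : ‖A‖ ≤ 1) (v : H) :
    ∃ ν : Measure ℝ, IsFiniteMeasure ν ∧ ν (Set.Icc (-1) 1)ᶜ = 0 ∧
      ∀ p : Polynomial ℝ, ⟪v, Polynomial.aeval A p v⟫_ℂ = ((∫ x, p.eval x ∂ν : ℝ) : ℂ) := by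
  let X := spectrum ℝ A
  have hsa : ∀ f : C(X, ℝ), IsSelfAdjoint (cfcHom hA f) := fun f => cfcHom_predicate hA f
  let Φ : C(X, ℝ) →ₗ[ℝ] ℝ :=
    { toFun := fun f => (⟪v, cfcHom hA f v⟫_ℂ).re
      map_add' := fun f g => by simp
      map_smul' := fun c f => by
        simp [inner_smul_right_eq_smul] }
  let Ψ : C_c(X, ℝ) →ₗ[ℝ] ℝ :=
    { toFun := fun f => Φ f.toContinuousMap
      map_add' := fun f g => Φ.map_add _ _
      map_smul' := fun c f => Φ.map_smul _ _ }
  let Λ : C_c(X, ℝ) →ₚ[ℝ] ℝ := PositiveLinearMap.mk₀ Ψ (by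
    intro f hf
    have h1 : 0 ≤ cfcHom hA f.toContinuousMap := by
      rw [cfcHom_nonneg_iff]
      intro x; exact hf x
    rw [ContinuousLinearMap.nonneg_iff_isPositive] at h1
    exact (Complex.nonneg_iff.mp (h1.inner_nonneg_right v)).1)
  have hX : ∀ x ∈ spectrum ℝ A, x ∈ Set.Icc (-1 : ℝ) 1 := by
    intro x hx
    have := (spectrum.norm_le_norm_mul_of_mem hx).trans
      (mul_le_one₀ hA1 (norm_nonneg _) ContinuousLinearMap.norm_id_le)
    rw [Real.norm_eq_abs] at this
    exact abs_le.mp this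
  have : CompactSpace X := ContinuousFunctionalCalculus.compactSpace_spectrum A
  have : IsFiniteMeasure (RealRMK.rieszMeasure Λ) := inferInstance
  refine ⟨(RealRMK.rieszMeasure Λ).map Subtype.val, inferInstance, ?_, ?_⟩
  · rw [Measure.map_apply measurable_subtype_coe measurableSet_Icc.compl]
    have h0 : ((↑) : X → ℝ) ⁻¹' (Set.Icc (-1) 1)ᶜ = ∅ :=
      Set.eq_empty_of_forall_notMem fun x hx => hx (hX x x.2)
    rw [h0, measure_empty]
  · intro p
    rw [integral_map measurable_subtype_coe.aemeasurable
      p.continuous.aestronglyMeasurable]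
    let f : C(X, ℝ) := p.toContinuousMapOn X
    have h := RealRMK.integral_rieszMeasure Λ
      (CompactlySupportedContinuousMap.continuousMapEquiv f)
    have hp : Polynomial.aeval A p = cfcHom hA f := by
      rw [← cfc_polynomial p A hA, cfc_apply _ A hA]
      rfl
    have h2 : ∫ x : X, p.eval (x : ℝ) ∂(RealRMK.rieszMeasure Λ) = (⟪v, cfcHom hA f v⟫_ℂ).re := h
    rw [h2, hp]
    have := (hsa f).isSymmetric
    exact (this.coe_re_inner_self_apply v |>.symm)

/-! ### Spheres and balls in a regular tree -/

section Tree

variable {V : Type*} {T : SimpleGraph V}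

/-- The parent of a vertex `w` in the tree rooted at `o` is unique. -/
theorem eq_of_adj_of_dist_succ (hT : T.IsTree) {o v v' w : V} (hv : T.Adj v w) (hv' : T.Adj v' w)
    (h : T.dist o w = T.dist o v + 1) (h' : T.dist o w = T.dist o v' + 1) : v = v' := by
  obtain ⟨p, hp⟩ := hT.connected.exists_walk_length_eq_dist o v
  obtain ⟨p', hp'⟩ := hT.connected.exists_walk_length_eq_dist o v'
  have h1 : (p.concat hv).IsPath :=
    (p.concat hv).isPath_of_length_eq_dist (by rw [SimpleGraph.Walk.length_concat, hp, h])
  have h2 : (p'.concat hv').IsPath :=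
    (p'.concat hv').isPath_of_length_eq_dist (by rw [SimpleGraph.Walk.length_concat, hp', h'])
  have h4 : p.concat hv = p'.concat hv' := congrArg Subtype.val
    ((hT.isAcyclic.subsingleton_path o w).elim ⟨_, h1⟩ ⟨_, h2⟩)
  have := congrArg SimpleGraph.Walk.penultimate h4
  simpa using this

theorem exists_adj_dist_succ (hT : T.IsTree) {o w : V} {n : ℕ} (h : T.dist o w = n + 1) :
    ∃ v, T.Adj v w ∧ T.dist o v = n := by
  obtain ⟨p, hp⟩ := hT.connected.exists_walk_length_eq_dist o w
  have hnil : ¬ p.Nil := by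
    intro hn
    rw [SimpleGraph.Walk.length_eq_zero_iff.mpr hn] at hp
    omega
  refine ⟨p.penultimate, p.adj_penultimate hnil, ?_⟩
  have h1 : T.dist o p.penultimate ≤ p.dropLast.length := T.dist_le p.dropLast
  have h2 : p.dropLast.length + 1 = p.length := by
    have := congrArg SimpleGraph.Walk.length (p.concat_dropLast (p.adj_penultimate hnil))
    rwa [SimpleGraph.Walk.length_concat] at this
  have h3 := hT.dist_eq_dist_add_one_of_adj o (p.adj_penultimate hnil)
  omega

variable [T.LocallyFinite]

/-- The children of `v` in the tree rooted at `o`: the neighbours of `v` one step further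
from `o`. -/
noncomputable def children (T : SimpleGraph V) [T.LocallyFinite] (o v : V) : Finset V :=
  {c ∈ T.neighborFinset v | T.dist o c = T.dist o v + 1}

theorem mem_children {o v c : V} :
    c ∈ children T o v ↔ T.Adj v c ∧ T.dist o c = T.dist o v + 1 := by
  simp [children]

theorem children_root (o : V) : children T o o = T.neighborFinset o := by
  ext c
  simp only [mem_children, SimpleGraph.mem_neighborFinset, and_iff_left_iff_imp]
  intro h
  simp [SimpleGraph.dist_eq_one_iff_adj.mpr h]

open Classical in
theorem exists_neighborFinset_eq_insert_children (hT : T.IsTree) {o v : V} {n : ℕ}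
    (h : T.dist o v = n + 1) :
    ∃ w, T.dist o w = n ∧ w ∉ children T o v ∧
      T.neighborFinset v = insert w (children T o v) := by
  obtain ⟨w, hw, hd⟩ := exists_adj_dist_succ hT h
  refine ⟨w, hd, ?_, ?_⟩
  · rw [mem_children]; omega
  · ext c
    simp only [SimpleGraph.mem_neighborFinset, Finset.mem_insert, mem_children]
    constructor
    · intro hc
      rcases hT.dist_eq_dist_add_one_of_adj o hc with h1 | h1
      · exact Or.inl (eq_of_adj_of_dist_succ hT hc.symm hw h1 (by omega))
      · exact Or.inr ⟨hc, h1⟩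
    · rintro (rfl | hc)
      · exact hw.symm
      · exact hc.1

variable {q : ℕ}

theorem card_children_root (hreg : T.IsRegularOfDegree (q + 1)) (o : V) :
    (children T o o).card = q + 1 := by
  rw [children_root, SimpleGraph.card_neighborFinset_eq_degree, hreg o]

theorem card_children_of_ne (hT : T.IsTree) (hreg : T.IsRegularOfDegree (q + 1)) {o v : V}
    (h : v ≠ o) : (children T o v).card = q := by
  classical
  have hd : 0 < T.dist o v := hT.connected.pos_dist_of_ne h.symm
  obtain ⟨w, -, hw, hins⟩ := exists_neighborFinset_eq_insert_children (n := T.dist o v - 1) hT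
    (o := o) (v := v) (by omega)
  have := congrArg Finset.card hins
  rw [SimpleGraph.card_neighborFinset_eq_degree, hreg v, Finset.card_insert_of_notMem hw] at this
  omega

/-- Among the `q + 1` neighbours of a vertex other than `o`, one is closer to `o` and `q` are
farther away. -/
theorem sum_neighborFinset_dist {E : Type*} [AddCommMonoid E] (hT : T.IsTree)
    (hreg : T.IsRegularOfDegree (q + 1)) {o v : V} {n : ℕ} (h : T.dist o v = n + 1) (F : ℕ → E) :
    ∑ e ∈ T.neighborFinset v, F (T.dist o e) = F n + q • F (n + 2) := by
  classical
  obtain ⟨w, hwd, hw, hins⟩ := exists_neighborFinset_eq_insert_children hT h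
  rw [hins, Finset.sum_insert hw, hwd, Finset.sum_congr rfl (g := fun _ => F (n + 2)),
    Finset.sum_const, card_children_of_ne hT hreg]
  · rintro rfl; simp at h
  · intro c hc
    rw [(mem_children.mp hc).2, h]

open Classical in
/-- The sphere of radius `n` about `o`, generated level by level. -/
noncomputable def sphere (T : SimpleGraph V) [T.LocallyFinite] (o : V) : ℕ → Finset V
  | 0 => {o}
  | n + 1 => (sphere T o n).biUnion (children T o)

theorem mem_sphere (hT : T.IsTree) {o x : V} {n : ℕ} : x ∈ sphere T o n ↔ T.dist o x = n := by
  classical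
  induction n generalizing x with
  | zero =>
    rw [sphere, Finset.mem_singleton, hT.connected.dist_eq_zero_iff, eq_comm]
  | succ n ih =>
    simp only [sphere, Finset.mem_biUnion, mem_children, ih]
    constructor
    · rintro ⟨v, hv, -, hx⟩
      rw [hx, hv]
    · intro h
      obtain ⟨v, hv, hd⟩ := exists_adj_dist_succ hT h
      exact ⟨v, hd, hv, by rw [h, hd]⟩

theorem card_sphere_succ (hT : T.IsTree) (hreg : T.IsRegularOfDegree (q + 1)) (o : V) (n : ℕ) :
    (sphere T o (n + 1)).card = (q + 1) * q ^ n := by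
  classical
  induction n with
  | zero => simp [sphere, card_children_root hreg]
  | succ n ih =>
    rw [sphere, Finset.card_biUnion, Finset.sum_congr rfl (g := fun _ => q), Finset.sum_const, ih,
      smul_eq_mul, pow_succ, mul_assoc]
    · intro v hv
      rw [mem_sphere hT] at hv
      exact card_children_of_ne hT hreg (by rintro rfl; simp at hv)
    · intro v hv w hw hne
      rw [Function.onFun, Finset.disjoint_left]
      intro c hc hc'
      rw [mem_children] at hc hc'
      exact hne (eq_of_adj_of_dist_succ hT hc.1 hc'.1 hc.2 hc'.2)

theorem countable_of_isTree (hT : T.IsTree) : Countable V := by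
  obtain ⟨o⟩ := hT.connected.nonempty
  rw [← Set.countable_univ_iff]
  refine (Set.countable_iUnion fun n => (sphere T o n).countable_toSet).mono fun x _ => ?_
  exact Set.mem_iUnion.mpr ⟨T.dist o x, (mem_sphere hT).mpr rfl⟩

open Classical in
/-- The ball of radius `r` about `o`, as a finite set. -/
noncomputable def ballFinset (T : SimpleGraph V) [T.LocallyFinite] (o : V) (r : ℕ) : Finset V :=
  (Finset.range (r + 1)).biUnion (sphere T o)

theorem coe_ballFinset (hT : T.IsTree) (o : V) (r : ℕ) :
    (ballFinset T o r : Set V) = ball T o r := by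
  ext x
  simp [ballFinset, ball, mem_sphere hT]

theorem sum_ballFinset {E : Type*} [AddCommMonoid E] (hT : T.IsTree) (o : V) (r : ℕ)
    (F : ℕ → E) :
    ∑ x ∈ ballFinset T o r, F (T.dist o x) =
      ∑ n ∈ Finset.range (r + 1), (sphere T o n).card • F n := by
  classical
  rw [ballFinset, Finset.sum_biUnion]
  · refine Finset.sum_congr rfl fun n _ => ?_
    rw [← Finset.sum_const]
    exact Finset.sum_congr rfl fun x hx => by rw [(mem_sphere hT).mp hx]
  · intro m _ n _ hne
    rw [Function.onFun, Finset.disjoint_left]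
    intro x hx hx'
    rw [mem_sphere hT] at hx hx'
    exact hne (hx.symm.trans hx')

theorem ballCard_succ (hT : T.IsTree) (hreg : T.IsRegularOfDegree (q + 1)) (o : V) (r : ℕ) :
    ballCard T o (r + 1) = ballCard T o r + (q + 1) * q ^ r := by
  have h : ∀ r, ballCard T o r = ∑ n ∈ Finset.range (r + 1), ((sphere T o n).card : ℝ) := by
    intro r
    have := sum_ballFinset hT o r (fun _ => (1 : ℝ))
    simp only [Finset.sum_const, nsmul_eq_mul, mul_one] at this
    rw [ballCard, ← coe_ballFinset hT, Set.ncard_coe_finset, this]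
  rw [h, h, Finset.sum_range_succ, card_sphere_succ hT hreg]
  push_cast
  ring

theorem ballCard_zero (hT : T.IsTree) (o : V) : ballCard T o 0 = 1 := by
  rw [ballCard, ← coe_ballFinset hT, Set.ncard_coe_finset]
  simp [ballFinset, sphere]

theorem one_le_ballCard (hT : T.IsTree) (hreg : T.IsRegularOfDegree (q + 1)) (o : V) (r : ℕ) :
    1 ≤ ballCard T o r := by
  induction r with
  | zero => rw [ballCard_zero hT]
  | succ r ih =>
    have : (0 : ℝ) ≤ (q + 1) * q ^ r := by positivity
    rw [ballCard_succ hT hreg]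
    linarith

theorem ballCard_le (hq : 2 ≤ q) (hT : T.IsTree) (hreg : T.IsRegularOfDegree (q + 1)) (o : V)
    (r : ℕ) : ballCard T o r ≤ 3 * q ^ r := by
  induction r with
  | zero => rw [ballCard_zero hT]; norm_num
  | succ r ih =>
    have hq' : (2 : ℝ) ≤ q := by exact_mod_cast hq
    have hp : (0 : ℝ) < q ^ r := by positivity
    rw [ballCard_succ hT hreg, pow_succ]
    nlinarith

end Tree

/-! ### Distance-transitivity of the automorphism group -/

section Automorphisms

/-- A bijection between finite sets of equal size, with the image of one point prescribed. -/
theorem exists_bijOn_of_card_eq {V : Type*} {s t : Finset V} (h : s.card = t.card) (a b : V) :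
    ∃ f : V → V, Set.BijOn f s t ∧ (a ∈ s → b ∈ t → f a = b) := by
  classical
  by_cases hab : a ∈ s ∧ b ∈ t
  · let e : s ≃ t := (Finset.equivOfCardEq h).trans
      (Equiv.swap (Finset.equivOfCardEq h ⟨a, hab.1⟩) ⟨b, hab.2⟩)
    refine ⟨fun x => if hx : x ∈ s then e ⟨x, hx⟩ else x, ⟨?_, ?_, ?_⟩, ?_⟩
    · intro x hx
      simp [Finset.mem_coe.mp hx]
    · intro x hx y hy hxy
      simp only [Finset.mem_coe.mp hx, Finset.mem_coe.mp hy, dif_pos] at hxy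
      exact congrArg Subtype.val (e.injective (Subtype.ext hxy))
    · intro y hy
      refine ⟨e.symm ⟨y, hy⟩, (e.symm ⟨y, hy⟩).2, ?_⟩
      simp
    · intro _ _
      simp [e, hab.1]
  · let e : s ≃ t := Finset.equivOfCardEq h
    refine ⟨fun x => if hx : x ∈ s then e ⟨x, hx⟩ else x, ⟨?_, ?_, ?_⟩, ?_⟩
    · intro x hx
      simp [Finset.mem_coe.mp hx]
    · intro x hx y hy hxy
      simp only [Finset.mem_coe.mp hx, Finset.mem_coe.mp hy, dif_pos] at hxy
      exact congrArg Subtype.val (e.injective (Subtype.ext hxy))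
    · intro y hy
      refine ⟨e.symm ⟨y, hy⟩, (e.symm ⟨y, hy⟩).2, ?_⟩
      simp
    · exact fun ha hb => (hab ⟨ha, hb⟩).elim

variable {V : Type*} {T : SimpleGraph V} [T.LocallyFinite] {q : ℕ}

/-- Recursion along the levels of the rooted tree: `E v w` prescribes how the children of `v` are
mapped when `v` is mapped to `w`. -/
theorem exists_levelwise_map (hT : T.IsTree) (o o' : V) (E : V → V → V → V) :
    ∃ g : V → V, g o = o' ∧ ∀ v, ∀ c ∈ children T o v, g c = E v (g v) c := by
  have hpar : ∀ c, ∃ w, ∀ v, c ∈ children T o v → w = v := by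
    intro c
    by_cases h : ∃ w, c ∈ children T o w
    · obtain ⟨w, hw⟩ := h
      refine ⟨w, fun v hv => ?_⟩
      rw [mem_children] at hw hv
      exact eq_of_adj_of_dist_succ hT hw.1 hv.1 hw.2 hv.2
    · exact ⟨c, fun v hv => (h ⟨v, hv⟩).elim⟩
  choose par hpar using hpar
  let G : ℕ → V → V := fun n => Nat.rec (fun _ => o') (fun _ f x => E (par x) (f (par x)) x) n
  refine ⟨fun x => G (T.dist o x) x, by simp [G], fun v c hc => ?_⟩
  have hd := (mem_children.mp hc).2
  have hp := hpar c v hc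
  simp only [hd]
  change E (par c) (G (T.dist o v) (par c)) c = _
  rw [hp]

theorem mem_children_of_dist_succ (hT : T.IsTree) {o w : V} {n : ℕ} (h : T.dist o w = n + 1) :
    ∃ v, T.dist o v = n ∧ w ∈ children T o v := by
  obtain ⟨v, hv, hd⟩ := exists_adj_dist_succ hT h
  exact ⟨v, hd, mem_children.mpr ⟨hv, by rw [h, hd]⟩⟩

/-- Every vertex is reached from the root by passing to children. -/
theorem exists_geodesic (hT : T.IsTree) (o x : V) :
    ∃ α : ℕ → V, α 0 = o ∧ α (T.dist o x) = x ∧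
      ∀ n < T.dist o x, α (n + 1) ∈ children T o (α n) := by
  induction h : T.dist o x generalizing x with
  | zero => exact ⟨fun _ => o, rfl, hT.connected.dist_eq_zero_iff.mp h, by simp⟩
  | succ N ih =>
    obtain ⟨v, hv, hx⟩ := mem_children_of_dist_succ hT h
    obtain ⟨α, h0, hN, hα⟩ := ih v hv
    refine ⟨fun n => if n ≤ N then α n else x, by simpa using h0, by simp, fun n hn => ?_⟩
    rcases (Nat.lt_succ_iff.mp hn).lt_or_eq with h1 | rfl
    · simpa [h1.le, Nat.succ_le_iff.mpr h1] using hα n h1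
    · simpa [hN] using hx

/-- A map defined level by level from bijections between the sets of children is an
automorphism. -/
theorem exists_iso_of_levelwise (hT : T.IsTree) {o o' : V} {E : V → V → V → V} {g : V → V}
    (hE : ∀ v w, T.dist o v = T.dist o' w →
      Set.BijOn (E v w) (children T o v) (children T o' w))
    (hgo : g o = o') (hg : ∀ v, ∀ c ∈ children T o v, g c = E v (g v) c) :
    ∃ φ : T ≃g T, ∀ x, φ x = g x := by
  have hdist : ∀ n v, T.dist o v = n → T.dist o' (g v) = n := by
    intro n
    induction n with
    | zero =>
      intro v hv
      rw [← hT.connected.dist_eq_zero_iff.mp hv, hgo, SimpleGraph.dist_self]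
    | succ n ih =>
      intro c hc
      obtain ⟨v, hv, hcv⟩ := mem_children_of_dist_succ hT hc
      have h1 := (hE v (g v) (by rw [hv, ih v hv])).mapsTo hcv
      rw [← hg v c hcv, Finset.mem_coe, mem_children] at h1
      rw [h1.2, ih v hv]
  have hchild : ∀ v, ∀ c ∈ children T o v, g c ∈ children T o' (g v) := by
    intro v c hc
    rw [hg v c hc]
    exact (hE v (g v) (hdist _ v rfl).symm).mapsTo hc
  have huniq : ∀ {p c v w : V}, c ∈ children T p v → c ∈ children T p w → v = w := by
    intro p c v w hv hw
    rw [mem_children] at hv hw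
    exact eq_of_adj_of_dist_succ hT hv.1 hw.1 hv.2 hw.2
  have hinj' : ∀ n v w, T.dist o v = n → g v = g w → v = w := by
    intro n
    induction n with
    | zero =>
      intro v w hv hvw
      have hw := hdist _ w rfl
      rw [← hvw, hdist _ v hv] at hw
      rw [← hT.connected.dist_eq_zero_iff.mp hv, ← hT.connected.dist_eq_zero_iff.mp hw.symm]
    | succ n ih =>
      intro c d hc hcd
      have hd := hdist _ d rfl
      rw [← hcd, hdist _ c hc] at hd
      obtain ⟨v, hv, hcv⟩ := mem_children_of_dist_succ hT hc
      obtain ⟨w, hw, hdw⟩ := mem_children_of_dist_succ hT hd.symm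
      have hvw : v = w := ih v w hv (huniq (hchild v c hcv) (hcd ▸ hchild w d hdw))
      subst hvw
      rw [hg v c hcv, hg v d hdw] at hcd
      exact (hE v (g v) (hdist _ v rfl).symm).injOn hcv hdw hcd
  have hinj : Function.Injective g := fun v w => hinj' _ v w rfl
  have hsurj' : ∀ n w, T.dist o' w = n → ∃ v, g v = w := by
    intro n
    induction n with
    | zero => intro w hw; exact ⟨o, by rw [hgo, hT.connected.dist_eq_zero_iff.mp hw]⟩
    | succ n ih =>
      intro d hd
      obtain ⟨w, hw, hdw⟩ := mem_children_of_dist_succ hT hd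
      obtain ⟨v, rfl⟩ := ih w hw
      obtain ⟨c, hc, rfl⟩ := (hE v (g v) (hdist _ v rfl).symm).surjOn hdw
      exact ⟨c, hg v c hc⟩
  have hadj : ∀ {p v w : V}, T.Adj v w → w ∈ children T p v ∨ v ∈ children T p w := by
    intro p v w h
    rcases hT.dist_eq_dist_add_one_of_adj p h with h1 | h1
    · exact Or.inr (mem_children.mpr ⟨h.symm, h1⟩)
    · exact Or.inl (mem_children.mpr ⟨h, h1⟩)
  have hback : ∀ v w, g w ∈ children T o' (g v) → w ∈ children T o v := by
    intro v w h
    obtain ⟨c, hc, hcw⟩ := (hE v (g v) (hdist _ v rfl).symm).surjOn h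
    rw [← hg v c hc] at hcw
    rwa [← hinj hcw]
  refine ⟨⟨Equiv.ofBijective g ⟨hinj, fun w => hsurj' _ w rfl⟩, ?_⟩, fun _ => rfl⟩
  intro v w
  change T.Adj (g v) (g w) ↔ T.Adj v w
  constructor
  · intro h
    rcases hadj (p := o') h with h1 | h1
    · exact (mem_children.mp (hback _ _ h1)).1
    · exact (mem_children.mp (hback _ _ h1)).1.symm
  · intro h
    rcases hadj (p := o) h with h1 | h1
    · exact (mem_children.mp (hchild _ _ h1)).1
    · exact (mem_children.mp (hchild _ _ h1)).1.symm

/-- The automorphism group of a regular tree acts distance-transitively: the bijections between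
children can be chosen to match a geodesic from `o` to `x` with one from `o'` to `x'`. -/
theorem exists_iso_of_dist_eq (hT : T.IsTree) (hreg : T.IsRegularOfDegree (q + 1))
    {o o' x x' : V} (h : T.dist o x = T.dist o' x') : ∃ φ : T ≃g T, φ o = o' ∧ φ x = x' := by
  obtain ⟨α, hα0, hαx, hα⟩ := exists_geodesic hT o x
  obtain ⟨β, hβ0, hβx, hβ⟩ := exists_geodesic hT o' x'
  have hE : ∀ v w, ∃ f : V → V, T.dist o v = T.dist o' w →
      Set.BijOn f (children T o v) (children T o' w) ∧
        (α (T.dist o v + 1) ∈ children T o v → β (T.dist o v + 1) ∈ children T o' w →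
          f (α (T.dist o v + 1)) = β (T.dist o v + 1)) := by
    intro v w
    by_cases hvw : T.dist o v = T.dist o' w
    · have hcard : (children T o v).card = (children T o' w).card := by
        by_cases hv : v = o
        · subst hv
          rw [SimpleGraph.dist_self] at hvw
          rw [← hT.connected.dist_eq_zero_iff.mp hvw.symm, card_children_root hreg,
            card_children_root hreg]
        · have hw : w ≠ o' := by
            rintro rfl
            rw [SimpleGraph.dist_self] at hvw
            exact hv (hT.connected.dist_eq_zero_iff.mp hvw).symm
          rw [card_children_of_ne hT hreg hv, card_children_of_ne hT hreg hw]
      obtain ⟨f, hf⟩ := exists_bijOn_of_card_eq hcard (α (T.dist o v + 1)) (β (T.dist o v + 1))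
      exact ⟨f, fun _ => hf⟩
    · exact ⟨id, fun h => (hvw h).elim⟩
  choose E hE using hE
  obtain ⟨g, hgo, hg⟩ := exists_levelwise_map hT o o' E
  obtain ⟨φ, hφ⟩ := exists_iso_of_levelwise hT (fun v w hvw => (hE v w hvw).1) hgo hg
  refine ⟨φ, by rw [hφ, hgo], ?_⟩
  have key : ∀ n ≤ T.dist o x, T.dist o (α n) = n ∧ T.dist o' (β n) = n ∧ g (α n) = β n := by
    intro n
    induction n with
    | zero => intro _; simp [hα0, hβ0, hgo]
    | succ n ih =>
      intro hn
      obtain ⟨h1, h2, h3⟩ := ih (by omega)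
      have ha := hα n (by omega)
      have hb := hβ n (by omega)
      refine ⟨by rw [(mem_children.mp ha).2, h1], by rw [(mem_children.mp hb).2, h2], ?_⟩
      rw [hg _ _ ha, h3]
      have := (hE (α n) (β n) (by rw [h1, h2])).2
      rw [h1] at this
      exact this ha hb
  have hfin := (key _ le_rfl).2.2
  rw [hφ, ← hαx, hfin, h, hβx]

end Automorphisms

/-! ### Recursion for the spherical functions -/

section Spherical

variable {q : ℕ}

theorem sqrt_mul_self_cpow (q : ℕ) : (q : ℂ) ^ (1 / 2 : ℂ) * (q : ℂ) ^ (1 / 2 : ℂ) = q := by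
  have := Complex.cpow_nat_inv_pow (q : ℂ) (n := 2) two_ne_zero
  rw [← pow_two]
  rwa [one_div]

theorem cpow_half_eq_sqrt (q : ℕ) : (q : ℂ) ^ (1 / 2 : ℂ) = (√(q : ℝ) : ℝ) := by
  rw [Real.sqrt_eq_rpow, Complex.ofReal_cpow (Nat.cast_nonneg q)]
  simp

theorem cpow_eq_exp (hq : 2 ≤ q) (z : ℂ) : (q : ℂ) ^ z = Complex.exp (Real.log q * z) := by
  have : (q : ℂ) ≠ 0 := by exact_mod_cast (by omega : q ≠ 0)
  rw [Complex.cpow_def_of_ne_zero this, ← Complex.natCast_log]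

theorem log_pos_of_two_le (hq : 2 ≤ q) : 0 < Real.log q :=
  Real.log_pos (by exact_mod_cast (by omega : 1 < q))

theorem log_ne_zero_of_two_le (hq : 2 ≤ q) : Complex.log q ≠ 0 := by
  rw [← Complex.natCast_log]
  exact_mod_cast (log_pos_of_two_le hq).ne'

theorem cpow_I_mul_half_period (hq : 2 ≤ q) (j : ℤ) :
    (q : ℂ) ^ (Complex.I * ((period q / 2 * (j : ℝ) : ℝ) : ℂ)) = (-1) ^ j := by
  have hl' := log_ne_zero_of_two_le hq
  rw [cpow_eq_exp hq, ← Complex.exp_pi_mul_I, ← Complex.exp_int_mul]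
  congr 1
  rw [period]
  push_cast
  field_simp

theorem cpow_I_mul_sq_ne_one (hq : 2 ≤ q) {l : ℂ}
    (h : ¬ ∃ j : ℤ, l = ((period q / 2 * (j : ℝ) : ℝ) : ℂ)) :
    ((q : ℂ) ^ (Complex.I * l)) ^ 2 ≠ 1 := by
  intro h1
  have hl' := log_ne_zero_of_two_le hq
  rw [cpow_eq_exp hq, ← Complex.exp_nat_mul, Complex.exp_eq_one_iff] at h1
  obtain ⟨j, hj⟩ := h1
  refine h ⟨j, ?_⟩
  have hI : Complex.I ≠ 0 := Complex.I_ne_zero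
  rw [period]
  push_cast at hj ⊢
  have : Complex.I * (2 * Complex.log q * l) = Complex.I * (j * (2 * Real.pi)) := by
    linear_combination hj
  have := mul_left_cancel₀ hI this
  field_simp
  linear_combination this / 2

/-- The three relations that determine `n ↦ ω_l(n)`. They hold in both branches of the definition
of `sphericalFun`. -/
theorem sphericalFun_relations (hq : 2 ≤ q) (l : ℂ) :
    sphericalFun q l 0 = 1 ∧
    (q + 1) * sphericalFun q l 1 = √(q : ℝ) *
      ((q : ℂ) ^ (Complex.I * l) + (q : ℂ) ^ (-(Complex.I * l))) ∧
    ∀ n, q * sphericalFun q l (n + 2) + sphericalFun q l n = √(q : ℝ) *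
      ((q : ℂ) ^ (Complex.I * l) + (q : ℂ) ^ (-(Complex.I * l))) * sphericalFun q l (n + 1) := by
  have hq0 : (q : ℂ) ≠ 0 := by exact_mod_cast (by omega : q ≠ 0)
  have hss := sqrt_mul_self_cpow q
  rw [← cpow_half_eq_sqrt]
  set s := (q : ℂ) ^ (1 / 2 : ℂ) with hs
  have hs0 : s ≠ 0 := by rintro h; rw [h] at hss; exact hq0 (by simpa using hss.symm)
  have hsneg : (q : ℂ) ^ (-(1 / 2) : ℂ) = s⁻¹ := Complex.cpow_neg _ _
  have hq1 : s * s + 1 ≠ 0 := by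
    rw [hss]; exact_mod_cast (by omega : q + 1 ≠ 0)
  have hq1' : s ^ 2 + 1 ≠ 0 := by rwa [pow_two]
  set w := (q : ℂ) ^ (Complex.I * l) with hw
  have hw0 : w ≠ 0 := by rw [hw, cpow_eq_exp hq]; exact Complex.exp_ne_zero _
  have hwneg : (q : ℂ) ^ (-(Complex.I * l)) = w⁻¹ := Complex.cpow_neg _ _
  rw [hwneg]
  by_cases h : ∃ j : ℤ, l = ((period q / 2 * (j : ℝ) : ℝ) : ℂ)
  · -- Only `w = (-1) ^ j` enters, so the choice of `j` in `sphericalFun` plays no role.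
    have hwj : w = (-1) ^ h.choose := by
      rw [hw, ← cpow_I_mul_half_period hq, ← h.choose_spec]
    have hww : w * w = 1 := by
      rw [hwj, ← mul_zpow]; simp
    have hwi : w⁻¹ = w := inv_eq_of_mul_eq_one_left hww
    have hform : ∀ n : ℕ, sphericalFun q l n =
        (1 + (s - s⁻¹) / (s + s⁻¹) * n) * (w * s⁻¹) ^ n := by
      intro n
      rw [sphericalFun, dif_pos h, zpow_mul, ← hwj, hsneg, zpow_natCast, mul_pow,
        show (-((n : ℂ) / 2)) = (-(1 / 2)) * n by ring, Complex.cpow_mul_nat, hsneg, mul_assoc]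
    refine ⟨by rw [hform]; simp, ?_, fun n => ?_⟩
    · rw [hform, hwi, ← hss]
      push_cast
      field_simp
      ring
    · rw [hform, hform, hform, hwi, ← hss, pow_add, pow_add]
      push_cast
      field_simp
      linear_combination -(1 + s ^ 2 + s ^ 2 * n - n) * hww
  · have hw2 : w ^ 2 ≠ 1 := cpow_I_mul_sq_ne_one hq h
    have hw5 : w ^ 2 - 1 ≠ 0 := sub_ne_zero.mpr hw2
    have hform : ∀ n : ℕ, sphericalFun q l n =
        1 / (s + s⁻¹) * ((s * w - s⁻¹ * w⁻¹) / (w - w⁻¹)) * (s⁻¹ * w) ^ n +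
        1 / (s + s⁻¹) * ((s * w⁻¹ - s⁻¹ * w) / (w⁻¹ - w)) * (s⁻¹ * w⁻¹) ^ n := by
      intro n
      rw [sphericalFun, dif_neg h, cFun, cFun]
      have e1 : (q : ℂ) ^ (1 / 2 + Complex.I * l) = s * w := Complex.cpow_add _ _ hq0
      have e2 : (q : ℂ) ^ (-(1 / 2) - Complex.I * l) = s⁻¹ * w⁻¹ := by
        rw [sub_eq_add_neg, Complex.cpow_add _ _ hq0, hsneg, hwneg]
      have e3 : (q : ℂ) ^ (1 / 2 + Complex.I * -l) = s * w⁻¹ := by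
        rw [mul_neg, Complex.cpow_add _ _ hq0, hwneg]
      have e4 : (q : ℂ) ^ (-(1 / 2) - Complex.I * -l) = s⁻¹ * w := by
        rw [mul_neg, sub_neg_eq_add, Complex.cpow_add _ _ hq0, hsneg]
      have e5 : (q : ℂ) ^ (-((1 / 2 - Complex.I * l) * (n : ℂ))) = (s⁻¹ * w) ^ n := by
        rw [← neg_mul, Complex.cpow_mul_nat, neg_sub, sub_eq_neg_add, Complex.cpow_add _ _ hq0,
          hsneg]
      have e6 : (q : ℂ) ^ (-((1 / 2 + Complex.I * l) * (n : ℂ))) = (s⁻¹ * w⁻¹) ^ n := by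
        rw [← neg_mul, Complex.cpow_mul_nat, neg_add, Complex.cpow_add _ _ hq0, hsneg, hwneg]
      rw [e1, e2, e3, e4, e5, e6, hsneg, mul_neg, neg_neg, hwneg]
    refine ⟨?_, ?_, fun n => ?_⟩
    · rw [hform, show w⁻¹ - w = -(w - w⁻¹) by ring]
      field_simp
      ring
    · rw [hform, ← hss, show w⁻¹ - w = -(w - w⁻¹) by ring]
      field_simp
      ring
    · rw [hform, hform, hform, pow_add _ n 2, pow_add _ n 1, pow_add _ n 2, pow_add _ n 1,
        ← hss]
      generalize 1 / (s + s⁻¹) * ((s * w - s⁻¹ * w⁻¹) / (w - w⁻¹)) = A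
      generalize 1 / (s + s⁻¹) * ((s * w⁻¹ - s⁻¹ * w) / (w⁻¹ - w)) = B
      generalize (s⁻¹ * w) ^ n = C
      generalize (s⁻¹ * w⁻¹) ^ n = D
      field_simp
      ring

end Spherical

/-! ### The parameter space and its polynomial coordinates -/

section Parameter

variable {q : ℕ}

/-- The real number `q^{il} + q^{-il} = 2 cos (l log q)` attached to a parameter `l ∈ Λ_q`. -/
noncomputable def specParam (q : ℕ) (l : ℂ) : ℝ := (2 * Complex.cos (Real.log q * l)).re

theorem continuous_specParam (q : ℕ) : Continuous (specParam q) := by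
  unfold specParam
  fun_prop

theorem cpow_add_cpow_neg (hq : 2 ≤ q) (l : ℂ) :
    (q : ℂ) ^ (Complex.I * l) + (q : ℂ) ^ (-(Complex.I * l)) =
      2 * Complex.cos (Real.log q * l) := by
  rw [cpow_eq_exp hq, cpow_eq_exp hq, Complex.two_cos]
  congr 2 <;> ring

theorem cos_log_mul_I (q : ℕ) (t : ℝ) :
    Complex.cos (Real.log q * (Complex.I * t)) = (Real.cosh (Real.log q * t) : ℝ) := by
  rw [Complex.ofReal_cosh, ← Complex.cos_mul_I]
  push_cast
  congr 1
  ring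

theorem cos_log_half_period_add (hq : 2 ≤ q) (z : ℂ) :
    Complex.cos (Real.log q * ((period q / 2 : ℝ) + z)) = -Complex.cos (Real.log q * z) := by
  have hl := (log_pos_of_two_le hq).ne'
  rw [← Complex.cos_add_pi, mul_add, add_comm]
  congr 2
  rw [← Complex.ofReal_mul, period]
  congr 1
  field_simp

theorem specParam_I_mul (q : ℕ) (t : ℝ) :
    specParam q (Complex.I * t) = 2 * Real.cosh (Real.log q * t) := by
  rw [specParam, cos_log_mul_I]
  simp only [Complex.mul_re, Complex.re_ofNat, Complex.im_ofNat, Complex.ofReal_re, zero_mul,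
    sub_zero]

theorem specParam_half_period_add (hq : 2 ≤ q) (t : ℝ) :
    specParam q ((period q / 2 : ℝ) + Complex.I * t) = -(2 * Real.cosh (Real.log q * t)) := by
  rw [specParam, cos_log_half_period_add hq, cos_log_mul_I]
  simp only [Complex.mul_re, Complex.re_ofNat, Complex.im_ofNat, Complex.ofReal_re, zero_mul,
    sub_zero, Complex.neg_re, mul_neg]

theorem specParam_ofReal (q : ℕ) (t : ℝ) :
    specParam q t = 2 * Real.cos (Real.log q * t) := by
  rw [specParam, ← Complex.ofReal_mul, ← Complex.ofReal_cos]
  simp only [Complex.mul_re, Complex.re_ofNat, Complex.im_ofNat, Complex.ofReal_re, zero_mul,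
    sub_zero]

theorem mem_Lam {l : ℂ} : l ∈ Lam q ↔
    (∃ t ∈ Set.Icc (0 : ℝ) (1 / 2), l = Complex.I * t) ∨
    (∃ t ∈ Set.Ioo 0 (period q / 2), l = (t : ℝ)) ∨
    (∃ t ∈ Set.Icc (0 : ℝ) (1 / 2), l = (period q / 2 : ℝ) + Complex.I * t) := by
  simp only [Lam, verticalSet, Set.mem_union, Set.mem_image, or_assoc, Complex.ofReal_zero,
    zero_add, eq_comm]

theorem ofReal_specParam {l : ℂ} (hq : 2 ≤ q) (hl : l ∈ Lam q) :
    (specParam q l : ℂ) = 2 * Complex.cos (Real.log q * l) := by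
  rcases mem_Lam.mp hl with ⟨t, -, rfl⟩ | ⟨t, -, rfl⟩ | ⟨t, -, rfl⟩
  · rw [specParam_I_mul, cos_log_mul_I]; push_cast; rfl
  · rw [specParam_ofReal]; push_cast; rfl
  · rw [specParam_half_period_add hq, cos_log_half_period_add hq, cos_log_mul_I]; push_cast; ring

theorem two_cosh_half_log (hq : 2 ≤ q) :
    2 * Real.cosh (Real.log q * (1 / 2)) = √q + (√q)⁻¹ := by
  have h : (0 : ℝ) < q := by exact_mod_cast (by omega : 0 < q)
  have h1 : Real.exp (Real.log q * (1 / 2)) = √q := by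
    rw [Real.sqrt_eq_rpow, Real.rpow_def_of_pos h]
  rw [Real.cosh_eq, Real.exp_neg, h1]
  ring

theorem two_lt_sqrt_add_inv (hq : 2 ≤ q) : 2 < √(q : ℝ) + (√q)⁻¹ := by
  rw [← two_cosh_half_log hq]
  have := log_pos_of_two_le hq
  have := Real.one_lt_cosh.mpr (show Real.log q * (1 / 2) ≠ 0 by positivity)
  linarith

theorem two_cosh_le (hq : 2 ≤ q) {t : ℝ} (ht : t ∈ Set.Icc (0 : ℝ) (1 / 2)) :
    2 * Real.cosh (Real.log q * t) ≤ √q + (√q)⁻¹ := by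
  have hl := log_pos_of_two_le hq
  rw [← two_cosh_half_log hq]
  have : Real.cosh (Real.log q * t) ≤ Real.cosh (Real.log q * (1 / 2)) := by
    rw [Real.cosh_le_cosh, abs_of_nonneg (mul_nonneg hl.le ht.1), abs_of_nonneg (by positivity)]
    exact mul_le_mul_of_nonneg_left ht.2 hl.le
  linarith

theorem abs_specParam_le (hq : 2 ≤ q) {l : ℂ} (hl : l ∈ Lam q) :
    |specParam q l| ≤ √q + (√q)⁻¹ := by
  rcases mem_Lam.mp hl with ⟨t, ht, rfl⟩ | ⟨t, -, rfl⟩ | ⟨t, ht, rfl⟩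
  · rw [specParam_I_mul, abs_of_nonneg (by positivity)]
    exact two_cosh_le hq ht
  · rw [specParam_ofReal, abs_mul, abs_two]
    have := Real.abs_cos_le_one (Real.log q * t)
    linarith [two_lt_sqrt_add_inv hq]
  · rw [specParam_half_period_add hq, abs_neg, abs_of_nonneg (by positivity)]
    exact two_cosh_le hq ht

/-- The two trivial parameters `i/2` and `τ/2 + i/2`, at which `|ω_l| = 1`. -/
def trivialParams (q : ℕ) : Set ℂ :=
  {Complex.I / 2, ((period q / 2 : ℝ) : ℂ) + Complex.I / 2}

theorem neg_lt_specParam (hq : 2 ≤ q) {l : ℂ} (hl : l ∈ Lam q) (hl' : l ∉ trivialParams q) :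
    -(√q + (√q)⁻¹) < specParam q l := by
  rcases mem_Lam.mp hl with ⟨t, ht, rfl⟩ | ⟨t, -, rfl⟩ | ⟨t, ht, rfl⟩
  · rw [specParam_I_mul]
    linarith [Real.cosh_pos (Real.log q * t), two_lt_sqrt_add_inv hq]
  · rw [specParam_ofReal]
    linarith [Real.neg_one_le_cos (Real.log q * t), two_lt_sqrt_add_inv hq]
  · have hlog := log_pos_of_two_le hq
    have ht2 : t ≠ 1 / 2 := by
      rintro rfl
      refine hl' (Or.inr ?_)
      push_cast
      rw [Set.mem_singleton_iff]
      ring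
    rw [specParam_half_period_add hq, ← two_cosh_half_log hq]
    have : Real.cosh (Real.log q * t) < Real.cosh (Real.log q * (1 / 2)) := by
      rw [Real.cosh_lt_cosh, abs_of_nonneg (mul_nonneg hlog.le ht.1),
        abs_of_nonneg (by positivity)]
      exact mul_lt_mul_of_pos_left (lt_of_le_of_ne ht.2 ht2) hlog
    linarith

theorem specParam_sq_of_mem_trivialParams (hq : 2 ≤ q) {l : ℂ} (hl : l ∈ trivialParams q) :
    specParam q l ^ 2 = (√q + (√q)⁻¹) ^ 2 := by
  have e : Complex.I / 2 = Complex.I * ((1 / 2 : ℝ) : ℂ) := by push_cast; ring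
  rcases hl with rfl | rfl
  · rw [e, specParam_I_mul, two_cosh_half_log hq]
  · rw [e, specParam_half_period_add hq, two_cosh_half_log hq, neg_sq]

open Polynomial in
/-- The polynomials `p_n` with `ω_l(n) = p_n(ω_l(1))`. -/
noncomputable def sphPoly (q : ℕ) : ℕ → ℝ[X]
  | 0 => 1
  | 1 => X
  | n + 2 => C ((q : ℝ)⁻¹) * (((q : ℝ[X]) + 1) * X * sphPoly q (n + 1) - sphPoly q n)

/-- The eigenvalue `ω_l(1)` of the normalized adjacency operator, for `l ∈ Λ_q`. -/
noncomputable def eigenvalue (q : ℕ) (l : ℂ) : ℝ := √q / (q + 1) * specParam q l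

theorem sphericalFun_eq_eval (hq : 2 ≤ q) {l : ℂ} (hl : l ∈ Lam q) (n : ℕ) :
    sphericalFun q l n = ((sphPoly q n).eval (eigenvalue q l) : ℝ) := by
  obtain ⟨h0, h1, h2⟩ := sphericalFun_relations hq l
  rw [cpow_add_cpow_neg hq, ← ofReal_specParam hq hl] at h1
  simp only [cpow_add_cpow_neg hq, ← ofReal_specParam hq hl] at h2
  have hq0 : (q : ℂ) ≠ 0 := by exact_mod_cast (by omega : q ≠ 0)
  have hq1 : (q : ℂ) + 1 ≠ 0 := by exact_mod_cast (by omega : q + 1 ≠ 0)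
  induction n using Nat.twoStepInduction with
  | zero => simp [h0, sphPoly]
  | one =>
    rw [sphPoly, Polynomial.eval_X, eigenvalue]
    push_cast
    field_simp
    linear_combination h1
  | more n ih1 ih2 =>
    have h3 := h2 n
    rw [ih1, ih2] at h3
    rw [sphPoly]
    simp only [Polynomial.eval_mul, Polynomial.eval_sub, Polynomial.eval_C, Polynomial.eval_X,
      Polynomial.eval_add, Polynomial.eval_one, Polynomial.eval_natCast]
    rw [show (q + 1 : ℝ) * eigenvalue q l = √q * specParam q l by
      rw [eigenvalue]
      have : (q : ℝ) + 1 ≠ 0 := by positivity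
      field_simp]
    push_cast
    field_simp
    linear_combination h3

theorem measurableSet_Lam (q : ℕ) : MeasurableSet (Lam q) := by
  have hv : ∀ a, MeasurableSet (verticalSet a (Set.Icc 0 (1 / 2))) := fun a =>
    (isCompact_Icc.image (by fun_prop)).measurableSet
  have he := Complex.isometry_ofReal.isClosedEmbedding.measurableEmbedding
  exact ((hv 0).union (he.measurableSet_image.mpr measurableSet_Ioo)).union (hv _)

open Classical in
/-- A measurable section of the map `l ↦ ω_l(1)` from `Λ_q` onto `[-1, 1]`, where
`c = cos (l log q)`. Outside `[-1, 1]` its values are irrelevant. -/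
noncomputable def paramOfEigenvalue (q : ℕ) (x : ℝ) : ℂ :=
  let c := (q + 1) * x / √q / 2
  if 1 ≤ c then Complex.I * (Real.arcosh c / Real.log q : ℝ)
  else if c ≤ -1 then (period q / 2 : ℝ) + Complex.I * (Real.arcosh (-c) / Real.log q : ℝ)
  else (Real.arccos c / Real.log q : ℝ)

theorem measurable_paramOfEigenvalue (q : ℕ) : Measurable (paramOfEigenvalue q) := by
  have harc : Measurable Real.arcosh := by unfold Real.arcosh; fun_prop
  have hc : Measurable fun x : ℝ => (q + 1) * x / √q / 2 := by fun_prop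
  unfold paramOfEigenvalue
  refine Measurable.ite (measurableSet_le measurable_const hc) ?_
    (Measurable.ite (measurableSet_le hc measurable_const) ?_ ?_)
  · exact (Complex.measurable_ofReal.comp ((harc.comp hc).div_const _)).const_mul _
  · exact ((Complex.measurable_ofReal.comp ((harc.comp hc.neg).div_const _)).const_mul _).const_add _
  · exact Complex.measurable_ofReal.comp ((Real.continuous_arccos.measurable.comp hc).div_const _)

theorem paramOfEigenvalue_spec (hq : 2 ≤ q) {x : ℝ} (hx : x ∈ Set.Icc (-1 : ℝ) 1) :
    paramOfEigenvalue q x ∈ Lam q ∧ eigenvalue q (paramOfEigenvalue q x) = x := by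
  have hl := log_pos_of_two_le hq
  have hq0 : (0 : ℝ) < q := by exact_mod_cast (by omega : 0 < q)
  have hss : √(q : ℝ) * √q = q := Real.mul_self_sqrt hq0.le
  set c := (q + 1) * x / √q / 2 with hc
  have hx' : x = √q / (q + 1) * (2 * c) := by rw [hc]; field_simp
  have hcle : |c| ≤ Real.cosh (Real.log q * (1 / 2)) := by
    have h1 := two_cosh_half_log hq
    have h2 : √(q : ℝ) + (√q)⁻¹ = (q + 1) / √q := by field_simp; linarith
    have h3 : |c| = (q + 1) / √q / 2 * |x| := by
      rw [hc, show (q + 1) * x / √q / 2 = (q + 1) / √q / 2 * x by ring, abs_mul,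
        abs_of_pos (by positivity : 0 < ((q : ℝ) + 1) / √q / 2)]
    rw [h3]
    have h4 : |x| ≤ 1 := abs_le.mpr hx
    have h5 : 0 < ((q : ℝ) + 1) / √q / 2 := by positivity
    nlinarith
  have harc : ∀ d, 1 ≤ d → d ≤ Real.cosh (Real.log q * (1 / 2)) →
      Real.arcosh d / Real.log q ∈ Set.Icc (0 : ℝ) (1 / 2) := by
    intro d hd hd'
    refine ⟨div_nonneg (Real.arcosh_nonneg hd) hl.le, ?_⟩
    rw [div_le_iff₀ hl, mul_comm, ← Real.arcosh_cosh (x := Real.log q * (1 / 2)) (by positivity)]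
    exact (Real.arcosh_le_arcosh (by linarith) (by linarith)).mpr hd'
  have hmul : ∀ t, Real.log q * (t / Real.log q) = t := fun t => by field_simp
  rw [paramOfEigenvalue, ← hc]
  split_ifs with h1 h2
  · refine ⟨mem_Lam.mpr (Or.inl ⟨_, harc c h1 ((le_abs_self c).trans hcle), rfl⟩), ?_⟩
    rw [eigenvalue, specParam_I_mul, hmul, Real.cosh_arcosh h1, ← hx']
  · have h2' : 1 ≤ -c := by linarith
    refine ⟨mem_Lam.mpr (Or.inr (Or.inr ⟨_, harc (-c) h2' ((neg_le_abs c).trans hcle), rfl⟩)), ?_⟩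
    rw [eigenvalue, specParam_half_period_add hq, hmul, Real.cosh_arcosh h2']
    linear_combination -hx'
  · push Not at h1 h2
    refine ⟨mem_Lam.mpr (Or.inr (Or.inl ⟨_, ⟨?_, ?_⟩, rfl⟩)), ?_⟩
    · exact div_pos (Real.arccos_pos.mpr h1) hl
    · rw [show period q / 2 = Real.pi / Real.log q by rw [period]; ring]
      refine div_lt_div_of_pos_right (lt_of_le_of_ne (Real.arccos_le_pi c) ?_) hl
      intro h
      rw [Real.arccos_eq_pi] at h
      linarith
    · rw [eigenvalue, specParam_ofReal, hmul, Real.cos_arccos h2.le h1.le, ← hx']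

end Parameter

/-! ### Spectral measures for equivariant maps into a Hilbert space -/

section Representation

open scoped InnerProductSpace

variable {V : Type*} {T : SimpleGraph V} {H : Type*} [NormedAddCommGroup H]
  [InnerProductSpace ℂ H]

theorem dist_iso (g : T ≃g T) (x y : V) (hT : T.IsTree) : T.dist (g x) (g y) = T.dist x y := by
  have key : ∀ (g : T ≃g T) (x y : V), T.dist (g x) (g y) ≤ T.dist x y := by
    intro g x y
    obtain ⟨p, hp⟩ := hT.connected.exists_walk_length_eq_dist x y
    have := T.dist_le (p.map g.toHom)
    rw [SimpleGraph.Walk.length_map, hp] at this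
    exact this
  refine le_antisymm (key g x y) ?_
  simpa using key g.symm (g x) (g y)

/-- The vectors fixed by the stabilizer of the root `o`. -/
def fixedVectors (U : (T ≃g T) →* (H →L[ℂ] H)) (o : V) : Submodule ℂ H where
  carrier := {F | ∀ k : T ≃g T, k o = o → U k F = F}
  add_mem' := fun ha hb k hk => by rw [map_add, ha k hk, hb k hk]
  zero_mem' := fun k _ => map_zero _
  smul_mem' := fun c F hF k hk => by rw [map_smul, hF k hk]

theorem isClosed_fixedVectors (U : (T ≃g T) →* (H →L[ℂ] H)) (o : V) :
    IsClosed (fixedVectors U o : Set H) := by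
  have : (fixedVectors U o : Set H) = ⋂ k : T ≃g T, ⋂ _ : k o = o, {F | U k F = F} := by
    ext F; simp [fixedVectors]
  rw [this]
  exact isClosed_iInter fun k => isClosed_iInter fun _ =>
    isClosed_eq (U k).continuous continuous_id

theorem inner_map_left {U : (T ≃g T) →* (H →L[ℂ] H)}
    (hU : ∀ g F G, ⟪U g F, U g G⟫_ℂ = ⟪F, G⟫_ℂ) (g : T ≃g T) (F G : H) :
    ⟪U g F, G⟫_ℂ = ⟪F, U g⁻¹ G⟫_ℂ := by
  rw [← hU g F, ← mul_apply_eq_comp, ← map_mul, mul_inv_cancel, map_one]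
  rfl

theorem sum_smul_mem_fixedVectors {U : (T ≃g T) →* (H →L[ℂ] H)} {φ : V → H}
    (hφ : ∀ g x, U g (φ x) = φ (g x)) {o : V} {f : V → ℂ} (hf : IsFinRadial T o f) :
    ∑ x ∈ hf.finite_support.toFinset, f x • φ x ∈ fixedVectors U o := by
  intro k hk
  rw [map_sum]
  refine Finset.sum_equiv k.toEquiv (fun x => ?_) (fun x _ => ?_)
  · simp [hf.radial k hk x]
  · rw [map_smul, hφ]
    simp [hf.radial k hk x]

variable [T.LocallyFinite] {q : ℕ}

/-- If `g_e o = e` for the neighbours `e` of the root, then `∑ₑ U(g_e)` preserves the fixed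
vectors, since left translation by the stabilizer permutes the cosets of the `g_e`. -/
theorem sum_neighbors_mem_fixedVectors {U : (T ≃g T) →* (H →L[ℂ] H)} {o : V}
    {γ : V → (T ≃g T)} (hγ : ∀ e, γ e o = e) {G : H} (hG : G ∈ fixedVectors U o) :
    ∑ e ∈ T.neighborFinset o, U (γ e) G ∈ fixedVectors U o := by
  intro k hk
  rw [map_sum]
  refine Finset.sum_equiv k.toEquiv (fun e => ?_) (fun e _ => ?_)
  · simp only [SimpleGraph.mem_neighborFinset]
    have := k.map_adj_iff (v := o) (w := e)
    rw [hk] at this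
    exact this.symm
  · have h1 : ((γ (k e))⁻¹ * (k * γ e)) o = o := by
      rw [RelIso.mul_apply, RelIso.mul_apply, hγ]
      nth_rw 2 [← hγ (k e)]
      exact (γ (k e)).symm_apply_apply o
    have h2 := hG _ h1
    have h3 : U (γ (k e)) (U ((γ (k e))⁻¹ * (k * γ e)) G) = U k (U (γ e) G) := by
      rw [← mul_apply_eq_comp, ← mul_apply_eq_comp, ← map_mul, ← map_mul,
        mul_inv_cancel_left]
    rw [← h3, h2]
    rfl

variable [CompleteSpace H]

/-- The inner products of radial combinations of an equivariant family `φ` are integrals of the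
corresponding products of the polynomials `p_n` against one finite measure on `[-1, 1]`. -/
theorem exists_sphericalSpectralMeasure (hT : T.IsTree)
    (hreg : T.IsRegularOfDegree (q + 1)) (hq : 2 ≤ q) (o : V) (U : (T ≃g T) →* (H →L[ℂ] H))
    (hU : ∀ g F G, ⟪U g F, U g G⟫_ℂ = ⟪F, G⟫_ℂ) (φ : V → H)
    (hφ : ∀ g x, U g (φ x) = φ (g x)) :
    ∃ ν : Measure ℝ, IsFiniteMeasure ν ∧ ν (Set.Icc (-1) 1)ᶜ = 0 ∧
      ∀ (f₁ f₂ : V → ℂ) (h₁ : IsFinRadial T o f₁) (h₂ : IsFinRadial T o f₂),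
        ⟪∑ y ∈ h₂.finite_support.toFinset, f₂ y • φ y,
          ∑ x ∈ h₁.finite_support.toFinset, f₁ x • φ x⟫_ℂ =
        ∑ y ∈ h₂.finite_support.toFinset, ∑ x ∈ h₁.finite_support.toFinset,
          conj (f₂ y) * f₁ x * ((∫ t, (sphPoly q (T.dist o y)).eval t *
            (sphPoly q (T.dist o x)).eval t ∂ν : ℝ) : ℂ) := by
  classical
  set I := fixedVectors U o
  have : CompleteSpace I := (isClosed_fixedVectors U o).completeSpace_coe
  set P := I.starProjection
  have hPmem : ∀ F, P F ∈ I := fun F => I.starProjection_apply_mem F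
  have hPid : ∀ F ∈ I, P F = F := fun F hF => I.starProjection_eq_self_iff.mpr hF
  have hP0 : ∀ F, (∀ G ∈ I, ⟪G, F⟫_ℂ = 0) → P F = 0 := fun F hF =>
    (I.starProjection_apply_eq_zero_iff).mpr ((I.mem_orthogonal F).mpr hF)
  have hPsymm : ∀ F G, ⟪P F, G⟫_ℂ = ⟪F, P G⟫_ℂ := fun F G =>
    I.inner_starProjection_left_eq_right F G
  have hUmul : ∀ g h F, U (g * h) F = U g (U h F) := fun g h F => by
    rw [map_mul]; rfl
  have hPU : ∀ k : T ≃g T, k o = o → ∀ F, P (U k F) = P F := by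
    intro k hk F
    rw [← sub_eq_zero, ← map_sub]
    refine hP0 _ fun G hG => ?_
    rw [inner_sub_right, ← hU k G F, hG k hk, sub_self]
  -- On fixed vectors, `P U_g P` depends only on the double coset of `g` modulo the stabilizer.
  have hcoset : ∀ g h : T ≃g T, T.dist o (g o) = T.dist o (h o) →
      ∀ F, P (U g (P F)) = P (U h (P F)) := by
    intro g h hgh F
    obtain ⟨k, hk, hkg⟩ := exists_iso_of_dist_eq hT hreg hgh
    have h1 : (h⁻¹ * (k * g)) o = o := by
      rw [RelIso.mul_apply, RelIso.mul_apply, hkg]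
      exact h.symm_apply_apply o
    rw [← hPU k hk, ← hUmul, ← mul_inv_cancel_left h (k * g), hUmul, hPmem F _ h1]
  choose γ hγ using fun e : V => (exists_iso_of_dist_eq hT hreg
    (show T.dist o o = T.dist e e by simp)).imp fun _ h => h.1
  have hγinv : ∀ e x, T.dist o ((γ e)⁻¹ x) = T.dist x e := by
    intro e x
    rw [← dist_iso (γ e) _ _ hT, hγ, SimpleGraph.dist_comm]
    congr 1
    exact (γ e).apply_symm_apply x
  obtain ⟨e₀, he₀⟩ : (T.neighborFinset o).Nonempty := by
    rw [← Finset.card_pos, SimpleGraph.card_neighborFinset_eq_degree, hreg o]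
    omega
  have hdist1 : ∀ e ∈ T.neighborFinset o, T.dist o e = 1 := fun e he =>
    SimpleGraph.dist_eq_one_iff_adj.mpr ((SimpleGraph.mem_neighborFinset _ _ _).mp he)
  -- The normalized adjacency operator on the fixed vectors.
  set A : H →L[ℂ] H := P ∘L U (γ e₀) ∘L P
  have hAe : ∀ e ∈ T.neighborFinset o, ∀ F, A F = P (U (γ e)⁻¹ (P F)) := by
    intro e he F
    refine hcoset _ _ ?_ F
    rw [hγinv, hγ, hdist1 e he, hdist1 e₀ he₀]
  -- The element `g⁻¹` lies in the double coset of `g`.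
  have hA : IsSelfAdjoint A := by
    rw [ContinuousLinearMap.isSelfAdjoint_iff_isSymmetric]
    intro F G
    change ⟪A F, G⟫_ℂ = ⟪F, A G⟫_ℂ
    rw [hAe e₀ he₀ G]
    change ⟪P (U (γ e₀) (P F)), G⟫_ℂ = _
    rw [hPsymm, inner_map_left hU, hPsymm]
  have hA1 : ‖A‖ ≤ 1 := by
    refine ContinuousLinearMap.opNorm_le_bound _ zero_le_one fun F => ?_
    have hP1 : ∀ F, ‖P F‖ ≤ ‖F‖ := fun F => I.norm_starProjection_apply_le F
    have hU1 : ∀ g F, ‖U g F‖ = ‖F‖ := fun g F => by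
      rw [@norm_eq_sqrt_re_inner ℂ, @norm_eq_sqrt_re_inner ℂ, hU]
    rw [one_mul]
    exact (hP1 _).trans ((hU1 _ _).le.trans (hP1 F))
  -- The projection of `φ x` depends only on the distance of `x` from the root.
  obtain ⟨u, hu⟩ : ∃ u : ℕ → H, ∀ x, P (φ x) = u (T.dist o x) := by
    have : ∀ n, ∃ w : H, ∀ x, T.dist o x = n → P (φ x) = w := by
      intro n
      by_cases h : ∃ y, T.dist o y = n
      · obtain ⟨y, hy⟩ := h
        refine ⟨P (φ y), fun x hx => ?_⟩
        obtain ⟨k, hk, hkx⟩ := exists_iso_of_dist_eq hT hreg (hx.trans hy.symm)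
        rw [← hPU k hk, hφ, hkx]
      · exact ⟨0, fun x hx => (h ⟨x, hx⟩).elim⟩
    choose u hu using this
    exact ⟨u, fun x => hu _ x rfl⟩
  have hAφ : ∀ x, ((q : ℂ) + 1) • A (u (T.dist o x)) =
      ∑ e ∈ T.neighborFinset o, u (T.dist x e) := by
    intro x
    have hPP : P (u (T.dist o x)) = P (φ x) := by rw [← hu, hPid _ (hPmem _)]
    have h1 : ((q : ℂ) + 1) • A (u (T.dist o x)) =
        ∑ e ∈ T.neighborFinset o, P (U (γ e)⁻¹ (P (φ x))) := by
      rw [Finset.sum_congr rfl (g := fun _ => A (u (T.dist o x))), Finset.sum_const,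
        SimpleGraph.card_neighborFinset_eq_degree, hreg o, ← Nat.cast_smul_eq_nsmul ℂ]
      · push_cast; rfl
      · intro e he; rw [hAe e he, hPP]
    have h2 : ∑ e ∈ T.neighborFinset o, P (U (γ e)⁻¹ (P (φ x) - φ x)) = 0 := by
      rw [← map_sum]
      refine hP0 _ fun G hG => ?_
      rw [inner_sum]
      have h3 : ∀ e, ⟪G, U (γ e)⁻¹ (P (φ x) - φ x)⟫_ℂ = ⟪U (γ e) G, P (φ x) - φ x⟫_ℂ :=
        fun e => (inner_map_left hU _ _ _).symm
      simp only [h3]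
      rw [← sum_inner, inner_sub_right, ← hPsymm,
        hPid _ (sum_neighbors_mem_fixedVectors hγ hG), sub_self]
    -- Replacing `P (φ x)` by `φ x` inside the sum costs nothing, by `h2`.
    rw [h1, ← sub_eq_zero, ← h2, ← Finset.sum_sub_distrib]
    refine Finset.sum_congr rfl fun e _ => ?_
    rw [map_sub, map_sub, hφ, hu ((γ e)⁻¹ x), hγinv]
  have hq0 : (q : ℂ) ≠ 0 := by exact_mod_cast (by omega : q ≠ 0)
  have hq1 : (q : ℂ) + 1 ≠ 0 := by exact_mod_cast (by omega : q + 1 ≠ 0)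
  have hu1 : u 1 = A (u 0) := by
    have h := hAφ o
    rw [SimpleGraph.dist_self, Finset.sum_congr rfl (g := fun _ => u 1), Finset.sum_const,
      SimpleGraph.card_neighborFinset_eq_degree, hreg o, ← Nat.cast_smul_eq_nsmul ℂ] at h
    · push_cast at h
      exact (smul_right_injective H hq1 h).symm
    · intro e he; rw [hdist1 e he]
  have hu2 : ∀ n, ((q : ℂ) + 1) • A (u (n + 1)) = u n + (q : ℂ) • u (n + 2) := by
    intro n
    obtain ⟨x, hx⟩ : (sphere T o (n + 1)).Nonempty := by
      rw [← Finset.card_pos, card_sphere_succ hT hreg]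
      have : 0 < q := by omega
      positivity
    rw [mem_sphere hT] at hx
    have h := hAφ x
    rw [hx, sum_neighborFinset_dist hT hreg (by rw [SimpleGraph.dist_comm, hx]) u] at h
    rw [h, Nat.cast_smul_eq_nsmul]
  have hun : ∀ n, u n = Polynomial.aeval A (sphPoly q n) (u 0) := by
    intro n
    induction n using Nat.twoStepInduction with
    | zero => simp [sphPoly]
    | one => simp [sphPoly, hu1]
    | more n ih1 ih2 =>
      have h := hu2 n
      have e : Polynomial.aeval A (sphPoly q (n + 2)) (u 0) =
          (q : ℂ)⁻¹ • (((q : ℂ) + 1) • A (Polynomial.aeval A (sphPoly q (n + 1)) (u 0)) -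
            Polynomial.aeval A (sphPoly q n) (u 0)) := by
        rw [sphPoly, Polynomial.C_mul', map_smul, map_sub, map_mul, map_mul, map_add, map_one,
          map_natCast, Polynomial.aeval_X]
        have hc : ∀ w : H, ((q : H →L[ℂ] H) + 1) w = ((q : ℂ) + 1) • w := by
          intro w
          rw [add_apply, add_smul, one_smul]
          congr 1
          rw [← nsmul_one, smul_apply, Nat.cast_smul_eq_nsmul]
          rfl
        rw [smul_apply, sub_apply,
          mul_apply_eq_comp, mul_apply_eq_comp, hc]
        rw [← Complex.coe_smul]
        push_cast
        rfl
      rw [e, ← ih1, ← ih2, h, add_sub_cancel_left, inv_smul_smul₀ hq0]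
  obtain ⟨ν, hν, hν1, hνp⟩ := exists_spectralMeasure A hA hA1 (u 0)
  refine ⟨ν, hν, hν1, fun f₁ f₂ h₁ h₂ => ?_⟩
  rw [← hPid _ (sum_smul_mem_fixedVectors hφ h₁), ← hPid _ (sum_smul_mem_fixedVectors hφ h₂),
    map_sum, map_sum, sum_inner]
  refine Finset.sum_congr rfl fun y _ => ?_
  rw [inner_sum]
  refine Finset.sum_congr rfl fun x _ => ?_
  have hsa : IsSelfAdjoint (Polynomial.aeval A (sphPoly q (T.dist o y))) := by
    rw [← cfc_polynomial _ A hA]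
    exact cfc_predicate _ A
  rw [map_smul, map_smul, inner_smul_left, inner_smul_right, hu, hu, hun (T.dist o y),
    hun (T.dist o x)]
  have hsymm := ContinuousLinearMap.isSelfAdjoint_iff_isSymmetric.mp hsa (u 0)
    (Polynomial.aeval A (sphPoly q (T.dist o x)) (u 0))
  simp only [ContinuousLinearMap.coe_coe] at hsymm
  rw [hsymm, ← mul_apply_eq_comp, ← map_mul, hνp]
  simp only [Polynomial.eval_mul]
  ring

end Representation

/-! ### The Koopman representation and the diffraction measure -/

section Koopman

open scoped InnerProductSpace

variable {V : Type*} {T : SimpleGraph V} {μ : Measure (V → ℝ≥0)}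

theorem measurePreserving_of_isInvariant (hinv : IsInvariant T μ) (g : T ≃g T) :
    MeasurePreserving (fun (p : V → ℝ≥0) (x : V) => p (g x)) μ μ :=
  ⟨by fun_prop, hinv g.symm⟩

/-- The Koopman representation of the automorphism group on `L²(μ)`: `(U_g F)(p) = F(g⁻¹ p)`. -/
noncomputable def koopman (hinv : IsInvariant T μ) :
    (T ≃g T) →* (Lp ℂ 2 μ →L[ℂ] Lp ℂ 2 μ) where
  toFun g := (Lp.compMeasurePreservingₗᵢ ℂ _
    (measurePreserving_of_isInvariant hinv g)).toContinuousLinearMap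
  map_one' := by
    ext1 F
    obtain ⟨f, hf, rfl⟩ : ∃ f, ∃ hf : MemLp f 2 μ, hf.toLp f = F :=
      ⟨F, Lp.memLp F, Lp.toLp_coeFn F _⟩
    rfl
  map_mul' g h := by
    ext1 F
    obtain ⟨f, hf, rfl⟩ : ∃ f, ∃ hf : MemLp f 2 μ, hf.toLp f = F :=
      ⟨F, Lp.memLp F, Lp.toLp_coeFn F _⟩
    rfl

theorem memLp_coord (hsq : IsLocallySquareIntegrable μ) (x : V) :
    MemLp (fun p : V → ℝ≥0 => ((p x : ℝ) : ℂ)) 2 μ := by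
  refine ⟨(Complex.measurable_ofReal.comp
    (measurable_coe_nnreal_real.comp (measurable_pi_apply x))).aestronglyMeasurable, ?_⟩
  rw [eLpNorm_lt_top_iff_lintegral_rpow_enorm_lt_top two_ne_zero ENNReal.ofNat_ne_top]
  convert hsq x using 3 with p
  have : ‖((p x : ℝ) : ℂ)‖ₑ = (p x : ℝ≥0∞) := by
    rw [← ofReal_norm, Complex.norm_real, NNReal.norm_eq, ENNReal.ofReal_coe_nnreal]
  rw [this]
  simp

/-- The evaluation `p ↦ p({x})` as an element of `L²(μ)`. -/
noncomputable def coord (hsq : IsLocallySquareIntegrable μ) (x : V) : Lp ℂ 2 μ :=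
  (memLp_coord hsq x).toLp _

theorem koopman_coord (hinv : IsInvariant T μ) (hsq : IsLocallySquareIntegrable μ)
    (g : T ≃g T) (x : V) : koopman hinv g (coord hsq x) = coord hsq (g x) := rfl

theorem inner_koopman (hinv : IsInvariant T μ) (g : T ≃g T) (F G : Lp ℂ 2 μ) :
    ⟪koopman hinv g F, koopman hinv g G⟫_ℂ = ⟪F, G⟫_ℂ :=
  (Lp.compMeasurePreservingₗᵢ ℂ _ (measurePreserving_of_isInvariant hinv g)).inner_map_map F G

theorem linearStatistic_eq_sum {f : V → ℂ} (hf : f.support.Finite) (p : V → ℝ≥0) :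
    linearStatistic f p = ∑ x ∈ hf.toFinset, ((p x : ℝ) : ℂ) * f x := by
  rw [linearStatistic]
  refine finsum_eq_sum_of_support_subset _ fun x hx => ?_
  rw [Function.mem_support] at hx
  simpa using right_ne_zero_of_mul hx

theorem sphericalTransform_eq_sum (q : ℕ) (o : V) {f : V → ℂ} (hf : f.support.Finite) (l : ℂ) :
    sphericalTransform q T o f l = ∑ x ∈ hf.toFinset, f x * sphericalFun q l (T.dist o x) := by
  rw [sphericalTransform]
  refine finsum_eq_sum_of_support_subset _ fun x hx => ?_
  rw [Function.mem_support] at hx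
  simpa using left_ne_zero_of_mul hx

theorem coeFn_sum_smul_coord (hsq : IsLocallySquareIntegrable μ) {f : V → ℂ}
    (hf : f.support.Finite) :
    ⇑(∑ x ∈ hf.toFinset, f x • coord hsq x) =ᵐ[μ] linearStatistic f := by
  have h1 : ∀ x, ⇑(f x • coord hsq x) =ᵐ[μ] fun p => ((p x : ℝ) : ℂ) * f x := by
    intro x
    filter_upwards [Lp.coeFn_smul (f x) (coord hsq x), (memLp_coord hsq x).coeFn_toLp]
      with p h2 h3
    rw [h2, Pi.smul_apply, coord, h3, smul_eq_mul, mul_comm]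
  have h2 : ∀ᵐ p ∂μ, ∀ x ∈ hf.toFinset, (f x • coord hsq x) p = ((p x : ℝ) : ℂ) * f x :=
    (Finset.eventually_all _).mpr fun x _ => h1 x
  filter_upwards [Lp.coeFn_finsetSum hf.toFinset (fun x => f x • coord hsq x), h2]
    with p h3 h4
  rw [h3, linearStatistic_eq_sum hf]
  simpa using Finset.sum_congr rfl h4

theorem integral_linearStatistic_mul_conj (hsq : IsLocallySquareIntegrable μ) {f₁ f₂ : V → ℂ}
    (h₁ : f₁.support.Finite) (h₂ : f₂.support.Finite) :
    ∫ p, linearStatistic f₁ p * conj (linearStatistic f₂ p) ∂μ =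
      ⟪∑ y ∈ h₂.toFinset, f₂ y • coord hsq y, ∑ x ∈ h₁.toFinset, f₁ x • coord hsq x⟫_ℂ := by
  rw [L2.inner_def]
  refine integral_congr_ae ?_
  filter_upwards [coeFn_sum_smul_coord hsq h₁, coeFn_sum_smul_coord hsq h₂] with p e1 e2
  rw [e1, e2]
  rfl

variable [T.LocallyFinite] {q : ℕ}

/-- Existence of the diffraction measure, so that `diffractionMeasure` is not the default value. -/
theorem exists_isDiffractionMeasure (hq : 2 ≤ q) (hT : T.IsTree)
    (hreg : T.IsRegularOfDegree (q + 1)) (o : V) (hinv : IsInvariant T μ)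
    (hsq : IsLocallySquareIntegrable μ) :
    ∃ σ : Measure ℂ, IsDiffractionMeasure q T o μ σ := by
  obtain ⟨ν, hν, hν1, hinner⟩ := exists_sphericalSpectralMeasure hT hreg hq o (koopman hinv)
    (inner_koopman hinv) (coord hsq) (koopman_coord hinv hsq)
  have hθ := measurable_paramOfEigenvalue q
  have hνae : ∀ᵐ t ∂ν, t ∈ Set.Icc (-1 : ℝ) 1 := hν1
  have hcarried : (ν.map (paramOfEigenvalue q)) (Lam q)ᶜ = 0 := by
    rw [Measure.map_apply hθ (measurableSet_Lam q).compl]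
    refine measure_mono_null (fun t ht => ?_) hν1
    exact fun ht' => ht (paramOfEigenvalue_spec hq ht').1
  have hae : ∀ᵐ l ∂(ν.map (paramOfEigenvalue q)), l ∈ Lam q := hcarried
  refine ⟨ν.map (paramOfEigenvalue q), inferInstance, hcarried, fun f₁ f₂ h₁ h₂ => ?_⟩
  rw [integral_linearStatistic_mul_conj hsq h₁.finite_support h₂.finite_support,
    hinner f₁ f₂ h₁ h₂]
  have hint : ∀ p : Polynomial ℝ, Integrable (fun t => ((p.eval t : ℝ) : ℂ)) ν := by
    intro p
    rw [← Measure.restrict_eq_self_of_ae_mem hνae]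
    exact (Complex.continuous_ofReal.comp p.continuous).integrableOn_Icc
  -- On `Λ_q` the spherical transforms are polynomials in the eigenvalue.
  let Q : ℂ → ℂ := fun l =>
    (∑ x ∈ h₁.finite_support.toFinset,
      f₁ x * ((sphPoly q (T.dist o x)).eval (eigenvalue q l) : ℝ)) *
    conj (∑ y ∈ h₂.finite_support.toFinset,
      f₂ y * (((sphPoly q (T.dist o y)).eval (eigenvalue q l) : ℝ) : ℂ))
  have hQc : Continuous Q := by
    have he : Continuous (eigenvalue q) := continuous_const.mul (continuous_specParam q)
    have hp : ∀ p : Polynomial ℝ, Continuous fun l => ((p.eval (eigenvalue q l) : ℝ) : ℂ) :=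
      fun p => Complex.continuous_ofReal.comp (p.continuous.comp he)
    refine (continuous_finsetSum _ fun x _ => continuous_const.mul (hp _)).mul
      (Complex.continuous_conj.comp (continuous_finsetSum _ fun x _ => continuous_const.mul (hp _)))
  have h1 : ∫ l in Lam q, sphericalTransform q T o f₁ l * conj (sphericalTransform q T o f₂ l)
      ∂(ν.map (paramOfEigenvalue q)) = ∫ l, Q l ∂(ν.map (paramOfEigenvalue q)) := by
    rw [setIntegral_congr_fun (measurableSet_Lam q) (g := Q),
      Measure.restrict_eq_self_of_ae_mem hae]
    intro l hl
    simp only [Q, sphericalTransform_eq_sum q o h₁.finite_support,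
      sphericalTransform_eq_sum q o h₂.finite_support, sphericalFun_eq_eval hq hl]
  rw [h1, integral_map hθ.aemeasurable hQc.aestronglyMeasurable]
  have h2 : ∫ t, Q (paramOfEigenvalue q t) ∂ν = ∫ t, ∑ y ∈ h₂.finite_support.toFinset,
      ∑ x ∈ h₁.finite_support.toFinset, conj (f₂ y) * f₁ x *
        (((sphPoly q (T.dist o y) * sphPoly q (T.dist o x)).eval t : ℝ) : ℂ) ∂ν := by
    refine integral_congr_ae ?_
    filter_upwards [hνae] with t ht
    simp only [Q, (paramOfEigenvalue_spec hq ht).2, map_sum, map_mul, Complex.conj_ofReal,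
      Polynomial.eval_mul, Complex.ofReal_mul]
    rw [Finset.sum_mul_sum, Finset.sum_comm]
    exact Finset.sum_congr rfl fun y _ => Finset.sum_congr rfl fun x _ => by ring
  rw [h2, integral_finsetSum _ fun y _ => integrable_finsetSum _ fun x _ =>
    (hint _).const_mul _]
  refine Finset.sum_congr rfl fun y _ => ?_
  rw [integral_finsetSum _ fun x _ => (hint _).const_mul _]
  refine Finset.sum_congr rfl fun x _ => ?_
  rw [integral_const_mul, integral_complex_ofReal]
  simp only [Polynomial.eval_mul]

theorem isDiffractionMeasure_diffractionMeasure (hq : 2 ≤ q) (hT : T.IsTree)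
    (hreg : T.IsRegularOfDegree (q + 1)) (o : V) (hinv : IsInvariant T μ)
    (hsq : IsLocallySquareIntegrable μ) :
    IsDiffractionMeasure q T o μ (diffractionMeasure q T o μ) := by
  rw [diffractionMeasure, dif_pos (exists_isDiffractionMeasure hq hT hreg o hinv hsq)]
  exact (exists_isDiffractionMeasure hq hT hreg o hinv hsq).choose_spec

end Koopman

/-! ### Transforms of balls -/

section Balls

variable {V : Type*} {T : SimpleGraph V} {q : ℕ}

theorem isFinRadial_indicator (hT : T.IsTree) {o : V} {s : Finset V} (D : ℕ → Prop)
    (hs : ∀ x, x ∈ s ↔ D (T.dist o x)) : IsFinRadial T o ((s : Set V).indicator 1) where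
  finite_support := s.finite_toSet.subset (Set.support_indicator_subset)
  radial k hk x := by
    have h : k x ∈ (s : Set V) ↔ x ∈ (s : Set V) := by
      rw [Finset.mem_coe, Finset.mem_coe, hs, hs]
      nth_rw 1 [← hk]
      rw [dist_iso k o x hT]
    by_cases hx : x ∈ (s : Set V)
    · rw [Set.indicator_of_mem hx, Set.indicator_of_mem (h.mpr hx)]; rfl
    · rw [Set.indicator_of_notMem hx, Set.indicator_of_notMem (fun h' => hx (h.mp h'))]

theorem toFinset_support_indicator_one {s : Finset V}
    (h : ((s : Set V).indicator (1 : V → ℂ)).support.Finite) : h.toFinset = s := by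
  ext x
  simp

theorem sphericalTransform_indicator (q : ℕ) (T : SimpleGraph V) (o : V) (s : Finset V) (l : ℂ) :
    sphericalTransform q T o ((s : Set V).indicator 1) l =
      ∑ x ∈ s, sphericalFun q l (T.dist o x) := by
  have h : ((s : Set V).indicator (1 : V → ℂ)).support.Finite :=
    s.finite_toSet.subset (Set.support_indicator_subset)
  rw [sphericalTransform_eq_sum q o h, toFinset_support_indicator_one]
  refine Finset.sum_congr rfl fun x hx => ?_
  rw [Set.indicator_of_mem (Finset.mem_coe.mpr hx), Pi.one_apply, one_mul]

/-- The normalized ball transforms: `q^{-r/2}` times the spherical transform of `χ_{B_r(o)}`, as a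
function of `y = 2 cos (l log q)`. -/
noncomputable def ballSeq (q : ℕ) (y : ℝ) : ℕ → ℝ
  | 0 => 1
  | 1 => (√q)⁻¹ + y
  | n + 2 => y * ballSeq q y (n + 1) - ballSeq q y n

theorem continuous_ballSeq (q r : ℕ) : Continuous fun y => ballSeq q y r := by
  induction r using Nat.twoStepInduction with
  | zero => exact continuous_const
  | one => exact continuous_const.add continuous_id
  | more n h1 h2 => exact (continuous_id.mul h2).sub h1

/-- The normalized ball transforms obey the recursion of `ballSeq`, because the adjacency operator
maps `χ_{B_{r+1}}` to `χ_{B_{r+2}} + q χ_{B_r}`. -/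
theorem sphericalTransform_ball [T.LocallyFinite] (hq : 2 ≤ q) (hT : T.IsTree)
    (hreg : T.IsRegularOfDegree (q + 1)) (o : V) (r : ℕ) {l : ℂ} (hl : l ∈ Lam q) :
    sphericalTransform q T o ((ball T o r).indicator 1) l =
      ((√(q : ℝ) ^ r * ballSeq q (specParam q l) r : ℝ) : ℂ) := by
  rw [← coe_ballFinset hT, sphericalTransform_indicator, sum_ballFinset hT]
  obtain ⟨h0, h1, h2⟩ := sphericalFun_relations hq l
  rw [cpow_add_cpow_neg hq, ← ofReal_specParam hq hl] at h1
  simp only [cpow_add_cpow_neg hq, ← ofReal_specParam hq hl] at h2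
  have hs0 : (√(q : ℝ) : ℂ) ≠ 0 := by
    have : (0 : ℝ) < q := by exact_mod_cast (by omega : 0 < q)
    exact_mod_cast (Real.sqrt_pos.mpr this).ne'
  have hss : (√(q : ℝ) : ℂ) ^ 2 = q := by
    rw [← Complex.ofReal_pow, Real.sq_sqrt (Nat.cast_nonneg q)]; simp
  set s : ℂ := (√(q : ℝ) : ℂ) with hs
  set y : ℂ := (specParam q l : ℂ) with hy
  set b : ℕ → ℂ := fun r => ∑ n ∈ Finset.range (r + 1), (sphere T o n).card • sphericalFun q l n
    with hb
  have hcard0 : (sphere T o 0).card = 1 := rfl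
  have hbsucc : ∀ n, b (n + 1) = b n + (q + 1) * q ^ n * sphericalFun q l (n + 1) := by
    intro n
    simp only [hb]
    rw [Finset.sum_range_succ _ (n + 1), card_sphere_succ hT hreg, nsmul_eq_mul]
    push_cast
    rfl
  have hb0 : b 0 = 1 := by simp [hb, hcard0, h0]
  have hb1 : b 1 = 1 + s * y := by
    rw [hbsucc, hb0, pow_zero, mul_one, h1]
  have hrec : ∀ n, b (n + 2) = s * y * b (n + 1) - q * b n := by
    intro n
    induction n with
    | zero =>
      have h3 := h2 0
      rw [h0] at h3
      rw [hbsucc, zero_add, hb1, hb0]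
      push_cast
      linear_combination (q + 1 : ℂ) * h3 + s * y * h1
    | succ n ih =>
      have h3 := h2 (n + 1)
      have e1 := hbsucc (n + 2)
      have e2 := hbsucc (n + 1)
      have e3 := hbsucc n
      linear_combination e1 + ih - s * y * e2 + q * e3 + (q + 1) * (q : ℂ) ^ (n + 1) * h3
  change b r = _
  induction r using Nat.twoStepInduction with
  | zero => simp [hb0, ballSeq]
  | one =>
    rw [hb1, ballSeq]
    push_cast
    rw [← hs, ← hy]
    field_simp
  | more n ih1 ih2 =>
    rw [hrec, ih1, ih2, ballSeq, ← hss]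
    push_cast
    rw [← hs, ← hy]
    ring

theorem ballSeq_quadratic_form (hq : 2 ≤ q) (y : ℝ) (r : ℕ) :
    ballSeq q y r ^ 2 - y * ballSeq q y r * ballSeq q y (r + 1) + ballSeq q y (r + 1) ^ 2 =
      (√q)⁻¹ * (√q + (√q)⁻¹ + y) := by
  have hs : √(q : ℝ) ≠ 0 := (Real.sqrt_pos.mpr (by exact_mod_cast (by omega : 0 < q))).ne'
  induction r with
  | zero =>
    simp only [ballSeq]
    field_simp
    ring
  | succ n ih =>
    rw [← ih, ballSeq]
    ring

/-- Two consecutive normalized ball transforms cannot both be small, because the quadratic form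
`a² - y a b + b²` is preserved by the recursion. -/
theorem le_ballSeq_sq_add_sq (hq : 2 ≤ q) (y : ℝ) (r : ℕ) :
    (√q)⁻¹ * (√q + (√q)⁻¹ + y) / (1 + |y| / 2) ≤
      ballSeq q y r ^ 2 + ballSeq q y (r + 1) ^ 2 := by
  rw [← ballSeq_quadratic_form hq y r, div_le_iff₀ (by positivity)]
  set a := ballSeq q y r
  set b := ballSeq q y (r + 1)
  have h1 : -(y * a * b) ≤ |y| * (|a| * |b|) := by
    rw [← abs_mul, ← abs_mul, mul_assoc]
    exact neg_le_abs _
  have h2 : |a| * |b| ≤ (a ^ 2 + b ^ 2) / 2 := by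
    nlinarith [sq_nonneg (|a| - |b|), sq_abs a, sq_abs b]
  nlinarith [mul_le_mul_of_nonneg_left h2 (abs_nonneg y)]

theorem inv_sqrt_lt_one (hq : 2 ≤ q) : (√(q : ℝ))⁻¹ < 1 := by
  refine inv_lt_one_of_one_lt₀ ?_
  rw [Real.lt_sqrt zero_le_one]
  exact_mod_cast (by omega : 1 ^ 2 < q)

theorem ballSeq_two (q r : ℕ) : ballSeq q 2 r = 1 + r * (1 + (√q)⁻¹) := by
  induction r using Nat.twoStepInduction with
  | zero => simp [ballSeq]
  | one => rw [ballSeq]; push_cast; ring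
  | more n h1 h2 => rw [ballSeq, h1, h2]; push_cast; ring

theorem ballSeq_neg_two (q r : ℕ) : ballSeq q (-2) r = (-1) ^ r * (1 + r * (1 - (√q)⁻¹)) := by
  induction r using Nat.twoStepInduction with
  | zero => simp [ballSeq]
  | one => rw [ballSeq]; push_cast; ring
  | more n h1 h2 => rw [ballSeq, h1, h2]; push_cast; ring

theorem le_ballSeq_sq_of_eq_two_or_eq_neg_two (hq : 2 ≤ q) {y : ℝ} (hy : y = 2 ∨ y = -2) (r : ℕ) :
    (r * (1 - (√q)⁻¹)) ^ 2 ≤ ballSeq q y r ^ 2 := by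
  have h1 := inv_sqrt_lt_one hq
  have h2 : 0 ≤ (√(q : ℝ))⁻¹ := by positivity
  have h3 : 0 ≤ r * (1 - (√(q : ℝ))⁻¹) := mul_nonneg (Nat.cast_nonneg r) (by linarith)
  rcases hy with rfl | rfl
  · rw [ballSeq_two]
    refine pow_le_pow_left₀ h3 ?_ 2
    nlinarith [mul_nonneg (Nat.cast_nonneg (α := ℝ) r) h2]
  · rw [ballSeq_neg_two, mul_pow ((-1 : ℝ) ^ r), ← pow_mul (-1 : ℝ), mul_comm r 2,
      pow_mul (-1 : ℝ), neg_one_sq, one_pow, one_mul]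
    exact pow_le_pow_left₀ h3 (by linarith) 2

/-- A solution of `a_{n+2} = (z + z⁻¹) a_{n+1} - a_n` with `a₁ ≥ z a₀` grows at least
like `z ^ n`. -/
theorem pow_le_of_recursion {a : ℕ → ℝ} {z : ℝ} (hz : 0 < z) (h0 : a 0 = 1) (h1 : z ≤ a 1)
    (h2 : ∀ n, a (n + 2) = (z + z⁻¹) * a (n + 1) - a n) (n : ℕ) : z ^ n ≤ a n := by
  have key : ∀ n, z * a n ≤ a (n + 1) := by
    intro n
    induction n with
    | zero => rw [h0, mul_one]; exact h1
    | succ n ih =>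
      have : a n ≤ z⁻¹ * a (n + 1) := by rwa [le_inv_mul_iff₀ hz]
      rw [h2]
      linarith
  induction n with
  | zero => simp [h0]
  | succ n ih =>
    rw [pow_succ']
    exact (mul_le_mul_of_nonneg_left ih hz.le).trans (key n)

/-- Exponential growth on the complementary series. For `y = -(z + z⁻¹)` the recursion holds for
`(-1)^n a_n`, and `z ≤ √q` gives the initial inequality. -/
theorem pow_le_ballSeq_sq {z : ℝ} (hz : 0 < z) (hz1 : z ≤ √q) {y : ℝ}
    (hy : y = z + z⁻¹ ∨ y = -(z + z⁻¹)) (r : ℕ) : (z ^ r) ^ 2 ≤ ballSeq q y r ^ 2 := by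
  have hs : 0 ≤ (√(q : ℝ))⁻¹ := by positivity
  have hz2 : (√(q : ℝ))⁻¹ ≤ z⁻¹ := inv_anti₀ hz hz1
  rcases hy with rfl | rfl
  · refine pow_le_pow_left₀ (by positivity)
      (pow_le_of_recursion hz rfl ?_ (fun n => rfl) r) 2
    rw [ballSeq]
    linarith
  · have h := pow_le_of_recursion (a := fun n => (-1) ^ n * ballSeq q (-(z + z⁻¹)) n) hz
      (by simp [ballSeq]) (by simp only [ballSeq]; linarith)
      (fun n => by simp only [ballSeq]; ring) r
    have h3 := pow_le_pow_left₀ (by positivity) h 2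
    rwa [mul_pow ((-1 : ℝ) ^ r), ← pow_mul (-1 : ℝ), mul_comm r 2, pow_mul (-1 : ℝ), neg_one_sq,
      one_pow, one_mul] at h3

end Balls

/-! ### Degenerate point processes -/

section NonDegenerate

open scoped InnerProductSpace

variable {V : Type*} {T : SimpleGraph V} {q : ℕ} {μ : Measure (V → ℝ≥0)}

theorem sphericalFun_two_of_mem_trivialParams (hq : 2 ≤ q) {l : ℂ} (hl : l ∈ Lam q)
    (hl' : l ∈ trivialParams q) : sphericalFun q l 2 = 1 := by
  have hq0 : (0 : ℝ) < q := by exact_mod_cast (by omega : 0 < q)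
  have hss : √(q : ℝ) ^ 2 = q := Real.sq_sqrt hq0.le
  have hx : eigenvalue q l ^ 2 = 1 := by
    rw [eigenvalue, mul_pow, specParam_sq_of_mem_trivialParams hq hl']
    field_simp
    rw [hss]
  rw [sphericalFun_eq_eval hq hl]
  have : (sphPoly q 2).eval (eigenvalue q l) = 1 := by
    simp only [sphPoly, Polynomial.eval_mul, Polynomial.eval_sub, Polynomial.eval_C,
      Polynomial.eval_X, Polynomial.eval_add, Polynomial.eval_one, Polynomial.eval_natCast]
    field_simp
    linear_combination (q + 1 : ℝ) * hx
  rw [this, Complex.ofReal_one]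

theorem isClassConstant_of_forall_dist_two (hT : T.IsTree) {p : V → ℝ≥0}
    (h : ∀ z w, T.dist z w = 2 → p z = p w) : IsClassConstant T p := by
  have key : ∀ n x y, T.dist x y = 2 * n → p x = p y := by
    intro n
    induction n with
    | zero =>
      intro x y hxy
      rw [hT.connected.dist_eq_zero_iff.mp hxy]
    | succ n ih =>
      intro x y hxy
      obtain ⟨w, hw, hwd⟩ := exists_adj_dist_succ hT (n := 2 * n + 1) (by rw [hxy]; ring)
      obtain ⟨v, hv, hvd⟩ := exists_adj_dist_succ hT hwd
      refine (ih x v hvd).trans (h v y ?_)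
      have h1 := hT.connected.dist_triangle (u := v) (v := w) (w := y)
      rw [SimpleGraph.dist_eq_one_iff_adj.mpr hw, SimpleGraph.dist_eq_one_iff_adj.mpr hv] at h1
      have h2 := hT.connected.dist_triangle (u := x) (v := v) (w := y)
      omega
  intro x y hxy
  obtain ⟨n, hn⟩ := hxy
  exact key n x y (by omega)

variable [T.LocallyFinite]

/-- If the diffraction measure is carried by the two trivial parameters, then configurations are
almost surely constant on the two bipartition classes. -/
theorem ae_isClassConstant_of_diffraction (hq : 2 ≤ q) (hT : T.IsTree)
    (hreg : T.IsRegularOfDegree (q + 1)) {o : V} (hinv : IsInvariant T μ)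
    (hsq : IsLocallySquareIntegrable μ) {σ : Measure ℂ} (hσ : IsDiffractionMeasure q T o μ σ)
    (h0 : σ (Lam q \ trivialParams q) = 0) : ∀ᵐ p ∂μ, IsClassConstant T p := by
  have hae : ∀ᵐ l ∂σ, l ∈ Lam q ∧ l ∈ trivialParams q := by
    have h1 : ∀ᵐ l ∂σ, l ∈ Lam q := hσ.carried
    have h2 : ∀ᵐ l ∂σ, l ∉ Lam q \ trivialParams q := measure_eq_zero_iff_ae_notMem.mp h0
    filter_upwards [h1, h2] with l h3 h4
    exact ⟨h3, by_contra fun h5 => h4 ⟨h3, h5⟩⟩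
  have hr0 : IsFinRadial T o ((sphere T o 0 : Set V).indicator 1) :=
    isFinRadial_indicator hT (· = 0) fun x => mem_sphere hT
  have hr2 : IsFinRadial T o ((sphere T o 2 : Set V).indicator 1) :=
    isFinRadial_indicator hT (· = 2) fun x => mem_sphere hT
  have hsum : ∀ (s : Finset V), ∑ x ∈ s, (s : Set V).indicator (1 : V → ℂ) x • coord hsq x =
      ∑ x ∈ s, coord hsq x := by
    intro s
    refine Finset.sum_congr rfl fun x hx => ?_
    rw [Set.indicator_of_mem (Finset.mem_coe.mpr hx), Pi.one_apply, one_smul]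
  have ht0 : ∀ l ∈ Lam q, sphericalTransform q T o ((sphere T o 0 : Set V).indicator 1) l = 1 := by
    intro l hl
    rw [sphericalTransform_indicator]
    simp [sphere, (sphericalFun_relations hq l).1]
  have e00 := hσ.inner_eq _ _ hr0 hr0
  have e20 := hσ.inner_eq _ _ hr2 hr0
  rw [integral_linearStatistic_mul_conj hsq hr0.finite_support hr0.finite_support,
    toFinset_support_indicator_one, hsum] at e00
  rw [integral_linearStatistic_mul_conj hsq hr2.finite_support hr0.finite_support,
    toFinset_support_indicator_one, toFinset_support_indicator_one, hsum, hsum] at e20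
  have hev : ∫ l in Lam q, sphericalTransform q T o ((sphere T o 2 : Set V).indicator 1) l *
      conj (sphericalTransform q T o ((sphere T o 0 : Set V).indicator 1) l) ∂σ =
      ∫ l in Lam q, ((sphere T o 2).card : ℂ) *
      (sphericalTransform q T o ((sphere T o 0 : Set V).indicator 1) l *
      conj (sphericalTransform q T o ((sphere T o 0 : Set V).indicator 1) l)) ∂σ := by
    refine integral_congr_ae (ae_restrict_of_ae ?_)
    filter_upwards [hae] with l hl
    rw [ht0 l hl.1, sphericalTransform_indicator, Finset.sum_congr rfl (g := fun _ => (1 : ℂ))]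
    · simp
    · intro x hx
      rw [(mem_sphere hT).mp hx, sphericalFun_two_of_mem_trivialParams hq hl.1 hl.2]
  rw [hev, integral_const_mul, ← e00] at e20
  have hsphere0 : sphere T o 0 = {o} := rfl
  rw [hsphere0, Finset.sum_singleton, inner_sum] at e20
  have hcard : ((sphere T o 2).card : ℂ) ≠ 0 := by
    rw [card_sphere_succ hT hreg]
    have : (q + 1) * q ^ 1 ≠ 0 := by positivity
    exact_mod_cast this
  -- The inner product does not depend on the point of the sphere of radius two.
  have hin : ∀ x, T.dist o x = 2 → ⟪coord hsq o, coord hsq x⟫_ℂ =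
      ⟪coord hsq o, coord hsq o⟫_ℂ := by
    intro x hx
    have hconst : ∀ w ∈ sphere T o 2, ⟪coord hsq o, coord hsq w⟫_ℂ =
        ⟪coord hsq o, coord hsq x⟫_ℂ := by
      intro w hw
      rw [mem_sphere hT] at hw
      obtain ⟨k, hk, hkw⟩ := exists_iso_of_dist_eq hT hreg (hw.trans hx.symm)
      rw [← inner_koopman hinv k, koopman_coord, koopman_coord, hk, hkw]
    rw [Finset.sum_congr rfl hconst, Finset.sum_const, nsmul_eq_mul] at e20
    exact mul_left_cancel₀ hcard e20
  have heq : ∀ z w, T.dist z w = 2 → coord hsq z = coord hsq w := by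
    intro z w hzw
    have hq1 : (sphere T o 2).Nonempty := by
      rw [← Finset.card_pos, Nat.pos_iff_ne_zero]
      exact_mod_cast hcard
    obtain ⟨x, hx⟩ := hq1
    rw [mem_sphere hT] at hx
    obtain ⟨g, hgo, hgx⟩ := exists_iso_of_dist_eq hT hreg (hx.trans hzw.symm)
    have hox : coord hsq o = coord hsq x := by
      obtain ⟨k, hk, -⟩ := exists_iso_of_dist_eq hT hreg
        (show T.dist o o = T.dist x x by simp)
      have h1 : ⟪coord hsq x, coord hsq x⟫_ℂ = ⟪coord hsq o, coord hsq o⟫_ℂ := by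
        rw [← hk, ← koopman_coord hinv, inner_koopman]
      have h2 : ⟪coord hsq x, coord hsq o⟫_ℂ = ⟪coord hsq o, coord hsq o⟫_ℂ := by
        rw [← inner_conj_symm, hin x hx, inner_conj_symm]
      rw [← sub_eq_zero, ← inner_self_eq_zero (𝕜 := ℂ), inner_sub_left, inner_sub_right,
        inner_sub_right, h1, h2, hin x hx, sub_self]
    rw [← hgo, ← hgx, ← koopman_coord hinv, ← koopman_coord hinv, hox]
  have : Countable V := countable_of_isTree hT
  have hall : ∀ᵐ p ∂μ, ∀ z w, T.dist z w = 2 → p z = p w := by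
    refine ae_all_iff.mpr fun z => ae_all_iff.mpr fun w => ?_
    by_cases hzw : T.dist z w = 2
    · have h1 := (memLp_coord hsq z).coeFn_toLp
      have h2 := (memLp_coord hsq w).coeFn_toLp
      have h3 : (memLp_coord hsq z).toLp _ = (memLp_coord hsq w).toLp _ := heq z w hzw
      rw [h3] at h1
      filter_upwards [h1, h2] with p e1 e2 _
      rw [e1] at e2
      exact_mod_cast e2
    · exact Eventually.of_forall fun p h => (hzw h).elim
  exact hall.mono fun p hp => isClassConstant_of_forall_dist_two hT hp

end NonDegenerate

/-! ### Lower bounds for the number variance -/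

section Variance

variable {V : Type*} {T : SimpleGraph V} {q : ℕ} {μ : Measure (V → ℝ≥0)}

theorem measurableSet_trivialParams (q : ℕ) : MeasurableSet (trivialParams q) :=
  (measurableSet_singleton _).insert _

theorem integrableOn_comp_specParam (hq : 2 ≤ q) {σ : Measure ℂ} [IsFiniteMeasure σ]
    {F : ℝ → ℝ} (hF : Continuous F) :
    IntegrableOn (fun l => F (specParam q l)) (Lam q \ trivialParams q) σ := by
  obtain ⟨C, hC⟩ :=
    (isCompact_Icc (a := -(√(q : ℝ) + (√q)⁻¹)) (b := √q + (√q)⁻¹)).exists_bound_of_continuousOn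
      hF.continuousOn
  refine Measure.integrableOn_of_bounded (M := C) (measure_ne_top σ _)
    (hF.comp (continuous_specParam q)).aestronglyMeasurable ?_
  filter_upwards [ae_restrict_mem ((measurableSet_Lam q).diff (measurableSet_trivialParams q))]
    with l hl
  exact hC _ (abs_le.mp (abs_specParam_le hq hl.1))

theorem integrableOn_ballSeq_sq (hq : 2 ≤ q) (σ : Measure ℂ) [IsFiniteMeasure σ] (r : ℕ) :
    IntegrableOn (fun l => ballSeq q (specParam q l) r ^ 2) (Lam q \ trivialParams q) σ :=
  integrableOn_comp_specParam hq ((continuous_ballSeq q r).pow 2)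

/-- The sub-oscillatory number variance divided by `q ^ r`, in terms of the diffraction
measure `σ`; see `subOscNumberVariance_eq`. -/
noncomputable def normalizedVariance (q : ℕ) (σ : Measure ℂ) (r : ℕ) : ℝ :=
  ∫ l in Lam q \ trivialParams q, ballSeq q (specParam q l) r ^ 2 ∂σ

theorem mul_measureReal_le_normalizedVariance (hq : 2 ≤ q) {σ : Measure ℂ} [IsFiniteMeasure σ]
    {S : Set ℂ} (hS : MeasurableSet S) (hSL : S ⊆ Lam q \ trivialParams q) {c : ℝ} {r : ℕ}
    (h : ∀ l ∈ S, c ≤ ballSeq q (specParam q l) r ^ 2) :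
    c * σ.real S ≤ normalizedVariance q σ r := by
  have hi := integrableOn_ballSeq_sq hq σ r
  refine (setIntegral_ge_of_const_le_real hS (measure_ne_top σ S) h (hi.mono_set hSL)).trans ?_
  exact setIntegral_mono_set hi (Eventually.of_forall fun _ => sq_nonneg _)
    (LE.le.eventuallyLE hSL)

/-- Averaging over two consecutive radii bounds the normalized variance below along infinitely
many radii. -/
theorem exists_frequently_le_normalizedVariance (hq : 2 ≤ q) {σ : Measure ℂ} [IsFiniteMeasure σ]
    (h : σ (Lam q \ trivialParams q) ≠ 0) :
    ∃ c > 0, ∃ᶠ r in atTop, c ≤ normalizedVariance q σ r := by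
  set F : ℝ → ℝ := fun y => (√q)⁻¹ * (√q + (√q)⁻¹ + y) / (1 + |y| / 2)
  have hF : Continuous F :=
    Continuous.div (by fun_prop) (by fun_prop) fun y => by positivity
  have hm := (measurableSet_Lam q).diff (measurableSet_trivialParams q)
  have hFpos : ∀ l ∈ Lam q \ trivialParams q, 0 < F (specParam q l) := by
    intro l hl
    have := neg_lt_specParam hq hl.1 hl.2
    have h2 : 0 < √(q : ℝ) + (√q)⁻¹ + specParam q l := by linarith
    positivity
  have hpos : 0 < ∫ l in Lam q \ trivialParams q, F (specParam q l) ∂σ := by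
    rw [setIntegral_pos_iff_support_of_nonneg_ae
      (by filter_upwards [ae_restrict_mem hm] with l hl using (hFpos l hl).le)
      (integrableOn_comp_specParam hq hF)]
    rw [Set.inter_eq_self_of_subset_right
      (show _ ⊆ Function.support _ from fun l hl => (hFpos l hl).ne')]
    exact pos_iff_ne_zero.mpr h
  refine ⟨_, half_pos hpos, ?_⟩
  rw [frequently_atTop]
  intro N
  have hsum : ∫ l in Lam q \ trivialParams q, F (specParam q l) ∂σ ≤
      normalizedVariance q σ N + normalizedVariance q σ (N + 1) := by
    have h1 := integrableOn_ballSeq_sq hq σ N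
    have h2 := integrableOn_ballSeq_sq hq σ (N + 1)
    rw [normalizedVariance, normalizedVariance, ← integral_add h1 h2]
    exact integral_mono (integrableOn_comp_specParam hq hF) (h1.add h2)
      fun l => le_ballSeq_sq_add_sq hq _ _
  by_cases hN : (∫ l in Lam q \ trivialParams q, F (specParam q l) ∂σ) / 2 ≤
      normalizedVariance q σ N
  · exact ⟨N, le_rfl, hN⟩
  · exact ⟨N + 1, Nat.le_succ N, by linarith⟩

theorem half_period (q : ℕ) : period q / 2 = Real.pi / Real.log q := by
  rw [period]; ring

theorem measurableSet_verticalSet_Ico (a c d : ℝ) :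
    MeasurableSet (verticalSet a (Set.Ico c d)) := by
  have h : Isometry fun t : ℝ => (a : ℂ) + Complex.I * (t : ℂ) := by
    refine Isometry.of_dist_eq fun s t => ?_
    rw [dist_add_left, dist_eq_norm, ← mul_sub, norm_mul, Complex.norm_I, one_mul,
      ← dist_eq_norm, Complex.dist_of_im_eq (by simp)]
    simp [Real.dist_eq]
  exact h.isClosedEmbedding.measurableEmbedding.measurableSet_image.mpr measurableSet_Ico

theorem verticalSet_subset {a c : ℝ} (ha : a = 0 ∨ a = period q / 2) (hc : 0 ≤ c) :
    verticalSet a (Set.Ico c (1 / 2)) ⊆ Lam q \ trivialParams q := by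
  rintro l ⟨t, ht, rfl⟩
  have ht' : t ∈ Set.Icc (0 : ℝ) (1 / 2) := ⟨hc.trans ht.1, ht.2.le⟩
  refine ⟨?_, fun hl => ?_⟩
  · rcases ha with rfl | rfl
    · exact mem_Lam.mpr (Or.inl ⟨t, ht', by simp⟩)
    · exact mem_Lam.mpr (Or.inr (Or.inr ⟨t, ht', rfl⟩))
  · change (a : ℂ) + Complex.I * (t : ℂ) ∈ _ at hl
    have him : ((a : ℂ) + Complex.I * (t : ℂ)).im = 1 / 2 := by
      rcases hl with hl | hl
      · simp only [hl, Complex.div_ofNat_im, Complex.I_im]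
      · rw [Set.mem_singleton_iff.mp hl]
        simp only [Complex.add_im, Complex.ofReal_im, Complex.div_ofNat_im, Complex.I_im, zero_add]
    simp at him
    linarith [ht.2]

theorem critical_subset (q : ℕ) :
    ({0, ((period q / 2 : ℝ) : ℂ)} : Set ℂ) ⊆ Lam q \ trivialParams q := by
  have h := fun a ha => verticalSet_subset (q := q) (a := a) (c := 0) ha le_rfl
  have h0 : (0 : ℝ) ∈ Set.Ico (0 : ℝ) (1 / 2) := by norm_num
  rintro l (rfl | rfl)
  · exact h 0 (Or.inl rfl) ⟨0, h0, by simp⟩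
  · exact h _ (Or.inr rfl) ⟨0, h0, by simp⟩

variable [T.LocallyFinite]

theorem subOscNumberVariance_eq (hq : 2 ≤ q) (hT : T.IsTree)
    (hreg : T.IsRegularOfDegree (q + 1)) (o : V) (r : ℕ) :
    subOscNumberVariance q T o μ r =
      (q : ℝ) ^ r * normalizedVariance q (diffractionMeasure q T o μ) r := by
  rw [subOscNumberVariance, condVar, normalizedVariance, ← integral_const_mul]
  refine setIntegral_congr_fun
    ((measurableSet_Lam q).diff (measurableSet_trivialParams q)) fun l hl => ?_
  simp only [sphericalTransform_ball hq hT hreg o r hl.1, Complex.norm_real, Real.norm_eq_abs,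
    sq_abs, mul_pow]
  rw [← pow_mul, mul_comm r 2, pow_mul, Real.sq_sqrt (Nat.cast_nonneg q)]

theorem exists_frequently_le_variance_div (hq : 2 ≤ q) (hT : T.IsTree)
    (hreg : T.IsRegularOfDegree (q + 1)) (o : V)
    [IsFiniteMeasure (diffractionMeasure q T o μ)]
    (h : diffractionMeasure q T o μ (Lam q \ trivialParams q) ≠ 0) :
    ∃ c > 0, ∃ᶠ r in atTop, c ≤ subOscNumberVariance q T o μ r / ballCard T o r := by
  obtain ⟨c, hc, hfreq⟩ := exists_frequently_le_normalizedVariance hq h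
  refine ⟨c / 3, by positivity, hfreq.mono fun r hr => ?_⟩
  have hB := ballCard_le hq hT hreg o r
  have hB1 := one_le_ballCard hT hreg o r
  have hqr : (0 : ℝ) < (q : ℝ) ^ r := pow_pos (by exact_mod_cast (by omega : 0 < q)) r
  rw [subOscNumberVariance_eq hq hT hreg, le_div_iff₀ (by linarith)]
  calc c / 3 * ballCard T o r ≤ c / 3 * (3 * q ^ r) := by gcongr
    _ = q ^ r * c := by ring
    _ ≤ _ := by gcongr

theorem exists_eventually_le_variance_div_sq (hq : 2 ≤ q) (hT : T.IsTree)
    (hreg : T.IsRegularOfDegree (q + 1)) (o : V)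
    [IsFiniteMeasure (diffractionMeasure q T o μ)]
    (h : 0 < diffractionMeasure q T o μ {0, ((Real.pi / Real.log q : ℝ) : ℂ)}) :
    ∃ c > 0, ∀ᶠ r : ℕ in atTop,
      c ≤ subOscNumberVariance q T o μ r / ((r : ℝ) ^ 2 * ballCard T o r) := by
  rw [← half_period] at h
  set S : Set ℂ := {0, ((period q / 2 : ℝ) : ℂ)}
  set m := (diffractionMeasure q T o μ).real S
  have hm : 0 < m := ENNReal.toReal_pos h.ne' (measure_ne_top _ _)
  have hκ : 0 < 1 - (√(q : ℝ))⁻¹ := by linarith [inv_sqrt_lt_one hq]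
  have hparam : ∀ l ∈ S, specParam q l = 2 ∨ specParam q l = -2 := by
    rintro l (rfl | rfl)
    · left; simpa using specParam_I_mul q 0
    · right; simpa using specParam_half_period_add hq 0
  refine ⟨(1 - (√(q : ℝ))⁻¹) ^ 2 * m / 3, by positivity, ?_⟩
  -- The radius `0` is excluded, since there the quotient is the junk value `x / 0 = 0`.
  filter_upwards [eventually_gt_atTop 0] with r hr
  have hB := ballCard_le hq hT hreg o r
  have hB1 := one_le_ballCard hT hreg o r
  have hqr : (0 : ℝ) < (q : ℝ) ^ r := pow_pos (by exact_mod_cast (by omega : 0 < q)) r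
  have hr' : (0 : ℝ) < r := by exact_mod_cast hr
  have hI := mul_measureReal_le_normalizedVariance hq (σ := diffractionMeasure q T o μ)
    (S := S) ((measurableSet_singleton _).insert _) (critical_subset q)
    fun l hl => le_ballSeq_sq_of_eq_two_or_eq_neg_two hq (hparam l hl) r
  rw [subOscNumberVariance_eq hq hT hreg, le_div_iff₀ (by positivity)]
  calc (1 - (√(q : ℝ))⁻¹) ^ 2 * m / 3 * (r ^ 2 * ballCard T o r)
      ≤ (1 - (√(q : ℝ))⁻¹) ^ 2 * m / 3 * (r ^ 2 * (3 * q ^ r)) := by gcongr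
    _ = q ^ r * ((r * (1 - (√(q : ℝ))⁻¹)) ^ 2 * m) := by ring
    _ ≤ _ := by gcongr

theorem exists_eventually_le_variance_div_rpow (hq : 2 ≤ q) (hT : T.IsTree)
    (hreg : T.IsRegularOfDegree (q + 1)) (o : V)
    [IsFiniteMeasure (diffractionMeasure q T o μ)] {δ : ℝ} (hδ : 0 < δ) {a : ℝ}
    (ha : a = 0 ∨ a = period q / 2)
    (h : 0 < diffractionMeasure q T o μ (verticalSet a (Set.Ico (δ / 2) (1 / 2)))) :
    ∃ c > 0, ∀ᶠ r : ℕ in atTop,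
      c ≤ subOscNumberVariance q T o μ r / ballCard T o r ^ (1 + δ) := by
  set S := verticalSet a (Set.Ico (δ / 2) (1 / 2))
  set m := (diffractionMeasure q T o μ).real S
  have hm : 0 < m := ENNReal.toReal_pos h.ne' (measure_ne_top _ _)
  have hq0 : (0 : ℝ) < q := by exact_mod_cast (by omega : 0 < q)
  have hq1 : (1 : ℝ) ≤ q := by exact_mod_cast (by omega : 1 ≤ q)
  have hcosh : ∀ t : ℝ, 2 * Real.cosh (Real.log q * t) = (q : ℝ) ^ t + ((q : ℝ) ^ t)⁻¹ := by
    intro t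
    rw [Real.rpow_def_of_pos hq0, Real.cosh_eq, Real.exp_neg]
    ring
  have hgrow : ∀ r : ℕ, ∀ l ∈ S, (q ^ r : ℝ) ^ δ ≤ ballSeq q (specParam q l) r ^ 2 := by
    rintro r l ⟨t, ht, rfl⟩
    have hy : specParam q ((a : ℂ) + Complex.I * t) = (q : ℝ) ^ t + ((q : ℝ) ^ t)⁻¹ ∨
        specParam q ((a : ℂ) + Complex.I * t) = -((q : ℝ) ^ t + ((q : ℝ) ^ t)⁻¹) := by
      rcases ha with rfl | rfl
      · left; rw [Complex.ofReal_zero, zero_add, specParam_I_mul, hcosh]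
      · right; rw [specParam_half_period_add hq, hcosh]
    have hz : (q : ℝ) ^ t ≤ √q := by
      rw [Real.sqrt_eq_rpow]
      exact Real.rpow_le_rpow_of_exponent_le hq1 ht.2.le
    refine le_trans ?_ (pow_le_ballSeq_sq (Real.rpow_pos_of_pos hq0 t) hz hy r)
    rw [← pow_mul, ← Real.rpow_natCast, ← Real.rpow_natCast, ← Real.rpow_mul hq0.le,
      ← Real.rpow_mul hq0.le]
    refine Real.rpow_le_rpow_of_exponent_le hq1 ?_
    push_cast
    nlinarith [ht.1, Nat.cast_nonneg (α := ℝ) r]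
  refine ⟨m / 3 ^ (1 + δ), by positivity, Eventually.of_forall fun r => ?_⟩
  have hB := ballCard_le hq hT hreg o r
  have hB1 := one_le_ballCard hT hreg o r
  have hqr : (0 : ℝ) < (q : ℝ) ^ r := pow_pos hq0 r
  have hI := mul_measureReal_le_normalizedVariance hq (σ := diffractionMeasure q T o μ)
    (measurableSet_verticalSet_Ico a (δ / 2) (1 / 2)) (verticalSet_subset ha (by positivity))
    (hgrow r)
  have hB0 : 0 < ballCard T o r := by linarith
  rw [subOscNumberVariance_eq hq hT hreg, le_div_iff₀ (by positivity)]
  calc m / 3 ^ (1 + δ) * ballCard T o r ^ (1 + δ)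
      ≤ m / 3 ^ (1 + δ) * (3 * q ^ r) ^ (1 + δ) := by gcongr
    _ = q ^ r * ((q ^ r : ℝ) ^ δ * m) := by
      rw [Real.mul_rpow (by norm_num) hqr.le, Real.rpow_add hqr, Real.rpow_one]
      field_simp
    _ ≤ _ := by gcongr

end Variance

theorem coe_pos_limsup_of_frequently {f : ℕ → ℝ} (h : ∃ c > 0, ∃ᶠ r in atTop, c ≤ f r) :
    0 < limsup (fun r => (f r : EReal)) atTop := by
  obtain ⟨c, hc, hf⟩ := h
  refine lt_of_lt_of_le (EReal.coe_pos.mpr hc) (le_limsup_of_frequently_le ?_)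
  exact hf.mono fun r hr => EReal.coe_le_coe_iff.mpr hr

theorem coe_pos_liminf_of_eventually {f : ℕ → ℝ} (h : ∃ c > 0, ∀ᶠ r in atTop, c ≤ f r) :
    0 < liminf (fun r => (f r : EReal)) atTop := by
  obtain ⟨c, hc, hf⟩ := h
  refine lt_of_lt_of_le (EReal.coe_pos.mpr hc) (le_liminf_of_le (by isBoundedDefault) ?_)
  exact hf.mono fun r hr => EReal.coe_le_coe_iff.mpr hr

end TreeProcess

theorem theorem1p2 {V : Type*} (q : ℕ) (hq : 2 ≤ q)
    (T : SimpleGraph V) [T.LocallyFinite] (hT : T.IsTree) (hreg : T.IsRegularOfDegree (q + 1))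
    (o : V) (μ : Measure (V → ℝ≥0)) [IsProbabilityMeasure μ]
    (hinv : TreeProcess.IsInvariant T μ) (hsq : TreeProcess.IsLocallySquareIntegrable μ) :
    ((¬ ∀ᵐ p ∂μ, TreeProcess.IsClassConstant T p) →
      0 < limsup (fun r : ℕ =>
        ((TreeProcess.subOscNumberVariance q T o μ r / TreeProcess.ballCard T o r : ℝ) : EReal))
        atTop) ∧
    (0 < TreeProcess.diffractionMeasure q T o μ {0, ((Real.pi / Real.log q : ℝ) : ℂ)} →
      0 < liminf (fun r : ℕ =>
        ((TreeProcess.subOscNumberVariance q T o μ r /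
          ((r : ℝ) ^ 2 * TreeProcess.ballCard T o r) : ℝ) : EReal)) atTop) ∧
    (∀ δ : ℝ, δ ∈ Set.Ioo (0 : ℝ) 1 →
      (0 < TreeProcess.diffractionMeasure q T o μ
          (TreeProcess.verticalSet 0 (Set.Ico (δ / 2) (1 / 2))) ∨
        0 < TreeProcess.diffractionMeasure q T o μ
          (TreeProcess.verticalSet (Real.pi / Real.log q) (Set.Ico (δ / 2) (1 / 2)))) →
      0 < liminf (fun r : ℕ =>
        ((TreeProcess.subOscNumberVariance q T o μ r /
          TreeProcess.ballCard T o r ^ (1 + δ) : ℝ) : EReal)) atTop) := by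
  have hσ := TreeProcess.isDiffractionMeasure_diffractionMeasure hq hT hreg o hinv hsq
  have := hσ.finite
  refine ⟨fun hnd => ?_, fun h => ?_, fun δ hδ h => ?_⟩
  · refine TreeProcess.coe_pos_limsup_of_frequently
      (TreeProcess.exists_frequently_le_variance_div hq hT hreg o fun h0 => hnd ?_)
    exact TreeProcess.ae_isClassConstant_of_diffraction hq hT hreg hinv hsq hσ h0
  · exact TreeProcess.coe_pos_liminf_of_eventually
      (TreeProcess.exists_eventually_le_variance_div_sq hq hT hreg o h)
  · refine TreeProcess.coe_pos_liminf_of_eventually ?_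
    rcases h with h | h
    · exact TreeProcess.exists_eventually_le_variance_div_rpow hq hT hreg o hδ.1 (Or.inl rfl) h
    · rw [← TreeProcess.half_period] at h
      exact TreeProcess.exists_eventually_le_variance_div_rpow hq hT hreg o hδ.1 (Or.inr rfl) h
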